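/- Let $k$ be a positive integer and put $\lambda_k = \dfrac{\pi^2}{3k(k+1)}$. For $s \in (0,1)$ let $C_1, C_2, \ldots$ be independent events on a probability space with $\mathbf{P}(C_n) = 1 - e^{-ns}$ for every $n \ge 1$, and let $$A_k = \bigcap_{i=1}^{\infty} \left(C_i \cup C_{i+1} \cup \cdots \cup C_{i+k-1}\right)$$ be the event that no $k$ consecutive $C_n$ all fail to occur. Put $\kappa_k = 1$ if $k \ge 2$, and $\kappa_1 = \sqrt{2\pi}$. Then $$\exp\left(-\lambda_k s^{-1}\right) \le \mathbf{P}(A_k) \le \kappa_k\, s^{-\frac{2k-1}{2k}} \exp\left(-\lambda_k s^{-1}\right)(1 + o(1)),$$ where both inequalities hold for every $s \in (0,1)$ and $o(1)$ denotes a function of $s$, depending only on $k$, that tends to $0$ as $s \to 0^+$. -/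

import Mathlib

open Filter Topology MeasureTheory ProbabilityTheory

/-- `C 1, C 2, …` are independent events of the probability space `(Ω, P)` with
`P (C n) = 1 - exp (-n s)`. (The value `C 0` is not used.) -/
structure IsExpEvents {Ω : Type*} [MeasurableSpace Ω] (P : Measure Ω) (s : ℝ)
    (C : ℕ → Set Ω) : Prop where
  measurableSet : ∀ n : ℕ, 1 ≤ n → MeasurableSet (C n)
  indep : iIndepSet (fun n : ℕ => C (n + 1)) P
  prob : ∀ n : ℕ, 1 ≤ n → P.real (C n) = 1 - Real.exp (-(n * s))

/-- The event `A_k = ⋂_{i ≥ 1} (C_i ∪ C_{i+1} ∪ ⋯ ∪ C_{i+k-1})`: among the `C_i`, `i ≥ 1`,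
no `k` consecutive ones all fail to occur. -/
def noGap {Ω : Type*} (C : ℕ → Set Ω) (k : ℕ) : Set Ω :=
  ⋂ i ∈ Set.Ici (1 : ℕ), ⋃ j ∈ Set.Iio k, C (i + j)

/-- `λ_k = π² / (3 k (k + 1))`. -/
noncomputable def gapConst (k : ℕ) : ℝ :=
  Real.pi ^ 2 / (3 * k * (k + 1))

/-! Scan the trials in order, remembering how many further failures would be fatal. The survival
probability then satisfies the linear recursion `runProb` in the position `n` and the remaining
allowance `r`. Freeze the failure probability at `x = exp (-t)` and let `y` be the positive root of
`(1 + y + ⋯ + y ^ k) (1 - x) = 1`. The vector `geom r y / geom k y` is then reproduced by one step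
up to the factor `f = exp (-gapExp k t)` (`exp_neg_gapExp_mul`). So survival from `n` on should be
about `exp (-gapTail k s n)`, a Riemann sum for the integral of `gapExp k` divided by `s`.

That integral is exactly `gapConst k` (`integral_gapExp`): a shear turns it into twice the integral
of `gapPhi k` over the half-line, which the dilogarithm series evaluates.

Lower bound: with `t = n s`, the frozen solution is a subsolution (`le_runProb`), and monotonicity
of `gapExp` compares the sum with the integral.

Upper bound: moving the evaluation point from `n` to `n + r` gives a supersolution (`runProb_le`),
hence `limRunProb_le`. Convexity of `gapExp` (trapezoid rule) and `k * gapExp k t + log t → 0` at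
`0` give the power of `s` (`neg_gapTail_one_le`). For `k = 1` Stirling's formula gives the constant
`√(2π)`. For `k ≥ 4` the constant obtained is already at most `1`; for `k = 2, 3` the recursion is
first unfolded a few times (`exists_scaledConst_le_one`). -/

/-! ### Geometric sums and the root `y(t)`. -/

/-- The geometric sum `1 + y + ⋯ + y ^ (m - 1)`. -/
noncomputable def geom (m : ℕ) (y : ℝ) : ℝ := ∑ j ∈ Finset.range m, y ^ j

@[simp] lemma geom_zero (y : ℝ) : geom 0 y = 0 := by simp [geom]

@[simp] lemma geom_one (y : ℝ) : geom 1 y = 1 := by simp [geom]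

lemma geom_succ (m : ℕ) (y : ℝ) : geom (m + 1) y = geom m y + y ^ m := by
  simp [geom, Finset.sum_range_succ]

lemma geom_succ' (m : ℕ) (y : ℝ) : geom (m + 1) y = 1 + y * geom m y := by
  simp only [geom, Finset.sum_range_succ', Finset.mul_sum, pow_succ', pow_zero]
  ring

lemma continuous_geom (m : ℕ) : Continuous (geom m) := by
  unfold geom; fun_prop

lemma geom_nonneg (m : ℕ) {y : ℝ} (hy : 0 ≤ y) : 0 ≤ geom m y :=
  Finset.sum_nonneg fun _ _ => pow_nonneg hy _

lemma geom_mono_left {m l : ℕ} (h : m ≤ l) {y : ℝ} (hy : 0 ≤ y) : geom m y ≤ geom l y :=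
  Finset.sum_le_sum_of_subset_of_nonneg (Finset.range_mono h) fun _ _ _ => pow_nonneg hy _

lemma one_le_geom {m : ℕ} (hm : 1 ≤ m) {y : ℝ} (hy : 0 ≤ y) : 1 ≤ geom m y := by
  simpa using geom_mono_left hm hy

lemma geom_pos {m : ℕ} (hm : 1 ≤ m) {y : ℝ} (hy : 0 ≤ y) : 0 < geom m y :=
  zero_lt_one.trans_le (one_le_geom hm hy)

lemma geom_mono_right (m : ℕ) {y z : ℝ} (hy : 0 ≤ y) (h : y ≤ z) : geom m y ≤ geom m z :=
  Finset.sum_le_sum fun _ _ => pow_le_pow_left₀ hy h _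

lemma geom_strictMono {k : ℕ} (hk : 1 ≤ k) {y z : ℝ} (hy : 0 ≤ y) (h : y < z) :
    geom (k + 1) y < geom (k + 1) z := by
  have := geom_mono_right k hy h.le
  have h2 := one_le_geom hk (hy.trans h.le)
  rw [geom_succ', geom_succ']
  nlinarith

lemma geom_mul_pow_le {m l : ℕ} (h : m ≤ l) {y z : ℝ} (hy : 0 ≤ y) (hyz : y ≤ z) :
    geom m z * y ^ l ≤ geom m y * z ^ l := by
  simp only [geom, Finset.sum_mul]
  refine Finset.sum_le_sum fun j hj => ?_
  obtain ⟨d, rfl⟩ : ∃ d, l = j + d := ⟨l - j, by have := Finset.mem_range.1 hj; omega⟩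
  rw [pow_add, pow_add]
  have : y ^ d ≤ z ^ d := pow_le_pow_left₀ hy hyz d
  have h0 : 0 ≤ z ^ j * y ^ j := mul_nonneg (pow_nonneg (hy.trans hyz) _) (pow_nonneg hy _)
  nlinarith [mul_le_mul_of_nonneg_left this h0]

lemma geom_mul_geom_le {m l : ℕ} (h : m ≤ l) {y z : ℝ} (hy : 0 ≤ y) (hyz : y ≤ z) :
    geom m z * geom l y ≤ geom m y * geom l z := by
  induction l, h using Nat.le_induction with
  | base => rw [mul_comm]
  | succ l hl ih =>
    rw [geom_succ, geom_succ, mul_add, mul_add]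
    exact add_le_add ih (geom_mul_pow_le hl hy hyz)

/-- This monotonicity is what makes the frozen solution a subsolution in `le_runProb`. -/
lemma geom_div_geom_antitone {m k : ℕ} (hk : 1 ≤ k) (h : m ≤ k) {y z : ℝ} (hy : 0 ≤ y)
    (hyz : y ≤ z) : geom m z / geom k z ≤ geom m y / geom k y := by
  rw [div_le_div_iff₀ (geom_pos hk (hy.trans hyz)) (geom_pos hk hy)]
  exact geom_mul_geom_le h hy hyz

lemma one_sub_exp_neg_pos {t : ℝ} (ht : 0 < t) : 0 < 1 - Real.exp (-t) := by
  have : Real.exp (-t) < 1 := by rw [Real.exp_lt_one_iff]; linarith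
  linarith

lemma exists_root {k : ℕ} (hk : 1 ≤ k) {t : ℝ} (ht : 0 < t) :
    ∃ y : ℝ, 0 < y ∧ geom (k + 1) y * (1 - Real.exp (-t)) = 1 := by
  have hp := one_sub_exp_neg_pos ht
  have hp1 : 1 - Real.exp (-t) < 1 := by linarith [Real.exp_pos (-t)]
  set p := 1 - Real.exp (-t)
  have h1 : 1 < 1 / p := by rw [lt_div_iff₀ hp]; linarith
  have hb : 1 / p ≤ geom (k + 1) (1 / p) := by
    rw [geom_succ']
    have := one_le_geom hk (one_div_nonneg.2 hp.le)
    nlinarith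
  have hIVT := intermediate_value_Icc (f := geom (k + 1)) (one_div_nonneg.2 hp.le)
    (continuous_geom _).continuousOn
  have h0 : geom (k + 1) 0 = 1 := by rw [geom_succ']; simp
  obtain ⟨y, hy, hye⟩ := hIVT ⟨by rw [h0]; exact h1.le, hb⟩
  refine ⟨y, lt_of_le_of_ne hy.1 ?_, by rw [hye]; field_simp⟩
  rintro rfl
  rw [h0] at hye
  linarith

open Classical in
/-- For `t > 0`, the positive solution `y` of `(1 + y + ⋯ + y ^ k) (1 - exp (-t)) = 1`. -/
noncomputable def root (k : ℕ) (t : ℝ) : ℝ :=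
  if h : ∃ y : ℝ, 0 < y ∧ geom (k + 1) y * (1 - Real.exp (-t)) = 1 then h.choose else 0

lemma root_pos {k : ℕ} (hk : 1 ≤ k) {t : ℝ} (ht : 0 < t) : 0 < root k t := by
  rw [root, dif_pos (exists_root hk ht)]
  exact (exists_root hk ht).choose_spec.1

lemma geom_root {k : ℕ} (hk : 1 ≤ k) {t : ℝ} (ht : 0 < t) :
    geom (k + 1) (root k t) * (1 - Real.exp (-t)) = 1 := by
  rw [root, dif_pos (exists_root hk ht)]
  exact (exists_root hk ht).choose_spec.2

/-! ### Convexity and symmetry of `gapPhi`. -/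

/-- The sum `∑_{j < k} (k - j) y ^ j`. -/
noncomputable def topSum (k : ℕ) (y : ℝ) : ℝ := ∑ m ∈ Finset.range k, geom (m + 1) y

/-- The sum `∑_{d < k} (d + 1) y ^ d`. -/
noncomputable def botSum (k : ℕ) (y : ℝ) : ℝ := ∑ d ∈ Finset.range k, ((d : ℝ) + 1) * y ^ d

lemma topSum_succ (k : ℕ) (y : ℝ) : topSum (k + 1) y = topSum k y + geom (k + 1) y := by
  simp [topSum, Finset.sum_range_succ]

lemma topSum_succ' (k : ℕ) (y : ℝ) : topSum (k + 1) y = y * topSum k y + (k + 1) := by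
  induction k with
  | zero => simp [topSum]
  | succ k ih =>
    have h := topSum_succ k y
    rw [topSum_succ (k + 1), geom_succ']
    push_cast
    linear_combination ih - y * h

/-- The coefficients of the product rise `1, …, k` and then fall `k, …, 1`; `botSum` and `topSum`
are the two halves. -/
lemma geom_mul_geom_succ (k : ℕ) (y : ℝ) :
    geom k y * geom (k + 1) y = botSum k y + y ^ k * topSum k y := by
  induction k with
  | zero => simp [topSum, botSum]
  | succ k ih =>
    have e : botSum (k + 1) y = botSum k y + (k + 1) * y ^ k := by
      simp [botSum, Finset.sum_range_succ]
    have h1 := topSum_succ k y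
    have h2 := topSum_succ' k y
    have h3 := geom_succ k y
    rw [e, geom_succ (k + 1), pow_succ]
    linear_combination ih + y ^ k * (h2 - h1) - y * y ^ k * h1 + geom (k + 1) y * h3

lemma mul_geom_sub (k : ℕ) (y : ℝ) :
    k * geom k y - ∑ j ∈ Finset.range k, (j : ℝ) * y ^ j = topSum k y := by
  induction k with
  | zero => simp [topSum]
  | succ k ih =>
    rw [topSum_succ, ← ih, geom_succ, Finset.sum_range_succ]
    push_cast
    ring

lemma topSum_pos {k : ℕ} (hk : 1 ≤ k) {y : ℝ} (hy : 0 ≤ y) : 0 < topSum k y :=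
  Finset.sum_pos (fun m _ => geom_pos (by omega) hy) ⟨0, Finset.mem_range.2 hk⟩

lemma topSum_mono (k : ℕ) {y z : ℝ} (hy : 0 ≤ y) (h : y ≤ z) : topSum k y ≤ topSum k z :=
  Finset.sum_le_sum fun _ _ => geom_mono_right _ hy h

lemma botSum_nonneg (k : ℕ) {y : ℝ} (hy : 0 ≤ y) : 0 ≤ botSum k y :=
  Finset.sum_nonneg fun _ _ => mul_nonneg (by positivity) (pow_nonneg hy _)

lemma botSum_mul_pow_le (k : ℕ) {y z : ℝ} (hy : 0 ≤ y) (hyz : y ≤ z) :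
    botSum k z * y ^ k ≤ botSum k y * z ^ k := by
  simp only [botSum, Finset.sum_mul]
  refine Finset.sum_le_sum fun j hj => ?_
  have h : z ^ j * y ^ k ≤ y ^ j * z ^ k := by
    obtain ⟨d, hd⟩ : ∃ d, k = j + d := ⟨k - j, by have := Finset.mem_range.1 hj; omega⟩
    rw [hd, pow_add, pow_add]
    have : y ^ d ≤ z ^ d := pow_le_pow_left₀ hy hyz d
    have h0 : 0 ≤ z ^ j * y ^ j := mul_nonneg (pow_nonneg (hy.trans hyz) _) (pow_nonneg hy _)
    nlinarith [mul_le_mul_of_nonneg_left this h0]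
  have : (0:ℝ) ≤ j + 1 := by positivity
  nlinarith [mul_le_mul_of_nonneg_left h this]

/-- After `geom_mul_geom_succ` the ratio has the form `T / (B + T)` with `T = y ^ k * topSum k y`,
and `B / T` decreases because `botSum k y / y ^ k` decreases while `topSum` increases. By
`hasDerivAt_gapPhi` the ratio is minus the derivative of `gapPhi`. -/
lemma topSum_div_mono {k : ℕ} (hk : 1 ≤ k) {y z : ℝ} (hy : 0 ≤ y) (hyz : y ≤ z) :
    y ^ k * topSum k y / (geom k y * geom (k + 1) y) ≤
      z ^ k * topSum k z / (geom k z * geom (k + 1) z) := by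
  have hz := hy.trans hyz
  rw [div_le_div_iff₀ (mul_pos (geom_pos hk hy) (geom_pos (by omega) hy))
    (mul_pos (geom_pos hk hz) (geom_pos (by omega) hz)), geom_mul_geom_succ, geom_mul_geom_succ]
  have h1 := mul_le_mul_of_nonneg_left (botSum_mul_pow_le k hy hyz) (topSum_pos hk hy).le
  have h2 := mul_le_mul_of_nonneg_left (topSum_mono k hy hyz)
    (mul_nonneg (botSum_nonneg k hy) (pow_nonneg hz k))
  nlinarith

/-- The function `u ↦ log ((1 + y + ⋯ + y ^ k) / (1 + y + ⋯ + y ^ (k - 1)))` at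
`y = exp (-u)`. -/
noncomputable def gapPhi (k : ℕ) (u : ℝ) : ℝ :=
  Real.log (geom (k + 1) (Real.exp (-u))) - Real.log (geom k (Real.exp (-u)))

lemma hasDerivAt_geom_exp (m : ℕ) (u : ℝ) :
    HasDerivAt (fun u => geom m (Real.exp (-u)))
      (-∑ j ∈ Finset.range m, (j : ℝ) * Real.exp (-u) ^ j) u := by
  have : ∀ j ∈ Finset.range m, HasDerivAt (fun u => Real.exp (-u) ^ j)
      (-((j : ℝ) * Real.exp (-u) ^ j)) u := by
    intro j _
    have h := ((hasDerivAt_neg u).exp).pow j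
    refine h.congr_deriv ?_
    rcases j with _ | j
    · simp
    · simp [pow_succ]; ring
  have h2 := HasDerivAt.fun_sum this
  rw [Finset.sum_neg_distrib] at h2
  exact h2

lemma hasDerivAt_gapPhi {k : ℕ} (hk : 1 ≤ k) (u : ℝ) :
    HasDerivAt (gapPhi k) (-(Real.exp (-u) ^ k * topSum k (Real.exp (-u)) /
      (geom k (Real.exp (-u)) * geom (k + 1) (Real.exp (-u))))) u := by
  have e := (Real.exp_pos (-u)).le
  have p1 := geom_pos hk e
  have p2 := geom_pos (m := k + 1) (by omega) e
  have h := ((hasDerivAt_geom_exp (k + 1) u).log p2.ne').sub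
    ((hasDerivAt_geom_exp k u).log p1.ne')
  refine h.congr_deriv ?_
  rw [← mul_geom_sub, Finset.sum_range_succ, geom_succ] at *
  field_simp
  ring

lemma convexOn_gapPhi {k : ℕ} (hk : 1 ≤ k) : ConvexOn ℝ Set.univ (gapPhi k) := by
  refine MonotoneOn.convexOn_of_deriv convex_univ
    (fun u _ => (hasDerivAt_gapPhi hk u).continuousAt.continuousWithinAt)
    (fun u _ => (hasDerivAt_gapPhi hk u).differentiableAt.differentiableWithinAt) ?_
  intro u _ v _ huv
  rw [(hasDerivAt_gapPhi hk u).deriv, (hasDerivAt_gapPhi hk v).deriv]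
  exact neg_le_neg (topSum_div_mono hk (Real.exp_pos _).le (Real.exp_le_exp.2 (by linarith)))

lemma continuous_gapPhi {k : ℕ} (hk : 1 ≤ k) : Continuous (gapPhi k) :=
  continuous_iff_continuousAt.2 fun u => (hasDerivAt_gapPhi hk u).continuousAt

lemma gapPhi_pos {k : ℕ} (hk : 1 ≤ k) (u : ℝ) : 0 < gapPhi k u := by
  have e := Real.exp_pos (-u)
  refine sub_pos.2 (Real.log_lt_log (geom_pos hk e.le) ?_)
  rw [geom_succ]
  linarith [pow_pos e k]

lemma geom_inv_mul_pow (m : ℕ) {y : ℝ} (hy : y ≠ 0) :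
    geom (m + 1) y⁻¹ * y ^ m = geom (m + 1) y := by
  induction m with
  | zero => simp
  | succ m ih =>
    rw [geom_succ', geom_succ (m + 1) y, ← ih, pow_succ]
    field_simp
    ring

/-- Geometric sums are palindromic, and the degrees of the two in `gapPhi` differ by one. -/
lemma gapPhi_neg {k : ℕ} (hk : 1 ≤ k) (u : ℝ) : gapPhi k (-u) = gapPhi k u + u := by
  obtain ⟨k, rfl⟩ : ∃ l, k = l + 1 := ⟨k - 1, by omega⟩
  have e := Real.exp_pos u
  have h : ∀ m, Real.log (geom (m + 1) (Real.exp u)) =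
      Real.log (geom (m + 1) (Real.exp (-u))) + m * u := by
    intro m
    rw [← geom_inv_mul_pow m e.ne', ← Real.exp_neg, Real.log_mul
      (geom_pos (by omega) (Real.exp_pos _).le).ne' (pow_pos e m).ne', Real.log_pow, Real.log_exp]
  rw [gapPhi, gapPhi, neg_neg, h, h]
  push_cast
  ring

/-- With `t = u + gapPhi k u` and `y = exp (-u)` this is the equation defining `root`, so `u ↦ (u +
gapPhi k u, gapPhi k u)` parametrises the graph of `gapExp k` over `t > 0`. -/
lemma exp_neg_add_gapPhi {k : ℕ} (hk : 1 ≤ k) (u : ℝ) :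
    Real.exp (-(u + gapPhi k u)) = 1 - 1 / geom (k + 1) (Real.exp (-u)) := by
  have e := Real.exp_pos (-u)
  have p1 := geom_pos hk e.le
  have p2 := geom_pos (m := k + 1) (by omega) e.le
  have : -(u + gapPhi k u) = -u + Real.log (geom k (Real.exp (-u))) -
      Real.log (geom (k + 1) (Real.exp (-u))) := by rw [gapPhi]; ring
  rw [this, Real.exp_sub, Real.exp_add, Real.exp_log p1, Real.exp_log p2, eq_sub_iff_add_eq,
    ← add_div, div_eq_one_iff_eq p2.ne', geom_succ']
  ring

lemma strictMono_add_gapPhi {k : ℕ} (hk : 1 ≤ k) : StrictMono fun u => u + gapPhi k u := by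
  intro u v huv
  have h := geom_strictMono hk (Real.exp_pos (-v)).le (Real.exp_lt_exp.2 (neg_lt_neg huv))
  have h2 : Real.exp (-(v + gapPhi k v)) < Real.exp (-(u + gapPhi k u)) := by
    rw [exp_neg_add_gapPhi hk, exp_neg_add_gapPhi hk]
    have := one_div_lt_one_div_of_lt (geom_pos (m := k + 1) (by omega) (Real.exp_pos (-v)).le) h
    linarith
  have := Real.exp_lt_exp.1 h2
  change u + gapPhi k u < v + gapPhi k v
  linarith

/-! ### The exponent `gapExp` as a shear of `gapPhi`. -/

/-- The exponent `-log f(exp (-t))`, where `f` is the decreasing solution of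
`f ^ k - f ^ (k + 1) = x ^ k - x ^ (k + 1)`. -/
noncomputable def gapExp (k : ℕ) (t : ℝ) : ℝ := gapPhi k (-Real.log (root k t))

lemma neg_log_root_add_gapExp {k : ℕ} (hk : 1 ≤ k) {t : ℝ} (ht : 0 < t) :
    -Real.log (root k t) + gapExp k t = t := by
  have h := exp_neg_add_gapPhi hk (-Real.log (root k t))
  rw [neg_neg, Real.exp_log (root_pos hk ht)] at h
  have h3 : 1 / geom (k + 1) (root k t) = 1 - Real.exp (-t) := by
    rw [div_eq_iff (geom_pos (by omega) (root_pos hk ht).le).ne', mul_comm, geom_root hk ht]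
  rw [h3] at h
  have := Real.exp_injective (h.trans (by ring : _ = Real.exp (-t)))
  rw [gapExp]
  linarith

lemma gapExp_pos {k : ℕ} (hk : 1 ≤ k) (t : ℝ) : 0 < gapExp k t := gapPhi_pos hk _

/-- Since `u + gapPhi k u` is strictly increasing, comparing `b` with `gapExp k t` amounts to
comparing `t - b` with `-log (root k t)`. Thus the shear `(t, b) ↦ (t - b, b)` carries the region
below one graph to the region below the other. -/
lemma lt_gapExp_iff {k : ℕ} (hk : 1 ≤ k) {t : ℝ} (ht : 0 < t) (b : ℝ) :
    b < gapExp k t ↔ b < gapPhi k (t - b) := by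
  have h := neg_log_root_add_gapExp hk ht
  have h2 := (strictMono_add_gapPhi hk).lt_iff_lt (a := -Real.log (root k t)) (b := t - b)
  have h3 : gapPhi k (-Real.log (root k t)) = gapExp k t := rfl
  simp only [h3] at h2
  rw [h] at h2
  constructor <;> intro hb
  · have := h2.2 (by linarith); linarith
  · have := h2.1 (by linarith); linarith

/-- A linear shear preserves convexity of the region on or above the graph, so the property passes
from `gapPhi` to `gapExp`. -/
lemma convexOn_gapExp {k : ℕ} (hk : 1 ≤ k) : ConvexOn ℝ (Set.Ioi 0) (gapExp k) := by
  refine ⟨convex_Ioi 0, ?_⟩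
  intro t ht s hs a b ha hb hab
  have hr : (0:ℝ) < a • t + b • s := convex_Ioi 0 ht hs ha hb hab
  have h1 := neg_log_root_add_gapExp hk ht
  have h2 := neg_log_root_add_gapExp hk hs
  by_contra! hlt
  rw [lt_gapExp_iff hk hr] at hlt
  have hc := (convexOn_gapPhi hk).2 (Set.mem_univ (-Real.log (root k t)))
    (Set.mem_univ (-Real.log (root k s))) ha hb hab
  have e : a • t + b • s - (a • gapExp k t + b • gapExp k s) =
      a • -Real.log (root k t) + b • -Real.log (root k s) := by
    simp only [smul_eq_mul]
    linear_combination -a * h1 - b * h2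
  rw [e] at hlt
  exact absurd hc (not_le.2 hlt)

lemma root_strictAnti {k : ℕ} (hk : 1 ≤ k) {s t : ℝ} (hs : 0 < s) (hst : s < t) :
    root k t < root k s := by
  have ht := hs.trans hst
  by_contra! h
  have h1 := geom_mono_right (k + 1) (root_pos hk hs).le h
  have e1 := geom_root hk hs
  have e2 := geom_root hk ht
  have h2 := one_le_geom (m := k + 1) (by omega) (root_pos hk hs).le
  have h3 : 1 - Real.exp (-s) < 1 - Real.exp (-t) := by
    linarith [Real.exp_lt_exp.2 (neg_lt_neg hst)]
  have := one_sub_exp_neg_pos hs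
  nlinarith

lemma root_anti {k : ℕ} (hk : 1 ≤ k) {s t : ℝ} (hs : 0 < s) (hst : s ≤ t) :
    root k t ≤ root k s := by
  rcases hst.eq_or_lt with rfl | h
  · exact le_rfl
  · exact (root_strictAnti hk hs h).le

lemma exp_neg_gapExp {k : ℕ} (hk : 1 ≤ k) {t : ℝ} (ht : 0 < t) :
    Real.exp (-gapExp k t) = geom k (root k t) / geom (k + 1) (root k t) := by
  have hr := root_pos hk ht
  rw [gapExp, gapPhi, neg_neg, Real.exp_log hr, neg_sub, Real.exp_sub,
    Real.exp_log (geom_pos hk hr.le), Real.exp_log (geom_pos (by omega) hr.le)]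

lemma gapExp_antitoneOn {k : ℕ} (hk : 1 ≤ k) : AntitoneOn (gapExp k) (Set.Ioi 0) := by
  intro s hs t ht hst
  have : Real.exp (-gapExp k s) ≤ Real.exp (-gapExp k t) := by
    rw [exp_neg_gapExp hk hs, exp_neg_gapExp hk ht]
    exact geom_div_geom_antitone (by omega) (by omega) (root_pos hk ht).le (root_anti hk hs hst)
  have := Real.exp_le_exp.1 this
  linarith

lemma root_mul_exp_neg_gapExp {k : ℕ} (hk : 1 ≤ k) {t : ℝ} (ht : 0 < t) :
    root k t * Real.exp (-gapExp k t) = Real.exp (-t) := by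
  have hr := root_pos hk ht
  conv_lhs => rw [← Real.exp_log hr, ← Real.exp_add]
  rw [Real.exp_eq_exp]
  linarith [neg_log_root_add_gapExp hk ht]

lemma one_sub_exp_neg_eq {k : ℕ} (hk : 1 ≤ k) {t : ℝ} (ht : 0 < t) :
    1 - Real.exp (-t) = 1 / geom (k + 1) (root k t) := by
  rw [eq_div_iff (geom_pos (by omega) (root_pos hk ht).le).ne', mul_comm, geom_root hk ht]

/-! ### The integral of `gapExp` is `gapConst`. -/

/-- Expand the logarithm in powers of `exp (-v)` and integrate termwise; the sum is `ζ(2)`. -/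
lemma integral_neg_log_one_sub_exp_neg :
    ∫ v in Set.Ioi (0 : ℝ), -Real.log (1 - Real.exp (-v)) = Real.pi ^ 2 / 6 := by
  have hi : ∀ n : ℕ, IntegrableOn (fun v : ℝ => Real.exp (-((n : ℝ) + 1) * v) / (n + 1))
      (Set.Ioi 0) := fun n => (integrableOn_exp_mul_Ioi (by linarith [n.cast_nonneg (α := ℝ)]) 0).div_const _
  have he : ∀ n : ℕ, ∫ v in Set.Ioi (0 : ℝ), Real.exp (-((n : ℝ) + 1) * v) / (n + 1) =
      1 / ((n + 1 : ℕ) : ℝ) ^ 2 := by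
    intro n
    rw [integral_div, integral_exp_mul_Ioi (by linarith [n.cast_nonneg (α := ℝ)]) 0]
    push_cast
    have : (n : ℝ) + 1 ≠ 0 := by positivity
    simp only [mul_zero, Real.exp_zero]
    rw [neg_div_neg_eq]
    field_simp
  have hz : HasSum (fun n : ℕ => 1 / ((n + 1 : ℕ) : ℝ) ^ 2) (Real.pi ^ 2 / 6) := by
    have := (hasSum_nat_add_iff' (f := fun n : ℕ => 1 / (n : ℝ) ^ 2) 1).2 hasSum_zeta_two
    simpa using this
  have hs := hasSum_integral_of_summable_integral_norm hi (by
    refine hz.summable.congr fun n => ?_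
    rw [← he n]
    refine setIntegral_congr_fun measurableSet_Ioi fun v _ => ?_
    rw [Real.norm_of_nonneg (by positivity)])
  simp only [he] at hs
  rw [hz.unique hs]
  refine setIntegral_congr_fun measurableSet_Ioi fun v hv => ?_
  have h1 : |Real.exp (-v)| < 1 := by
    rw [abs_of_pos (Real.exp_pos _), Real.exp_lt_one_iff]
    simpa using hv
  rw [← (Real.hasSum_pow_div_log_of_abs_lt_one h1).tsum_eq]
  congr 1
  ext n
  rw [← Real.exp_nat_mul]
  congr 2
  push_cast
  ring

lemma geom_mul_one_sub (m : ℕ) (y : ℝ) : geom m y * (1 - y) = 1 - y ^ m := by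
  rw [geom, mul_comm, mul_neg_geom_sum]

lemma gapPhi_eq {k : ℕ} (hk : 1 ≤ k) {u : ℝ} (hu : 0 < u) :
    gapPhi k u = -Real.log (1 - Real.exp (-(k * u))) -
      -Real.log (1 - Real.exp (-((k + 1 : ℕ) * u))) := by
  have h : ∀ m : ℕ, 1 ≤ m → Real.log (geom m (Real.exp (-u))) =
      Real.log (1 - Real.exp (-(m * u))) - Real.log (1 - Real.exp (-u)) := by
    intro m hm
    have hp := one_sub_exp_neg_pos hu
    have hg := geom_pos hm (Real.exp_pos (-u)).le
    rw [eq_sub_iff_add_eq, ← Real.log_mul hg.ne' hp.ne', geom_mul_one_sub, ← Real.exp_nat_mul,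
      mul_neg]
  rw [gapPhi, h _ hk, h _ (by omega)]
  ring

lemma integral_gapPhi {k : ℕ} (hk : 1 ≤ k) :
    ∫ u in Set.Ioi (0 : ℝ), gapPhi k u = gapConst k / 2 := by
  have hi : IntegrableOn (fun v : ℝ => -Real.log (1 - Real.exp (-v))) (Set.Ioi 0) := by
    -- The integral of a non-integrable function is `0` by convention, so a nonzero value proves
    -- integrability.
    refine Integrable.of_integral_ne_zero ?_
    rw [integral_neg_log_one_sub_exp_neg]
    positivity
  have hm : ∀ m : ℕ, 1 ≤ m →
      IntegrableOn (fun v : ℝ => -Real.log (1 - Real.exp (-(m * v)))) (Set.Ioi 0) ∧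
      ∫ v in Set.Ioi (0 : ℝ), -Real.log (1 - Real.exp (-(m * v))) = Real.pi ^ 2 / 6 / m := by
    intro m hm
    have hm' : (0 : ℝ) < m := by exact_mod_cast hm
    constructor
    · have := (integrableOn_Ioi_comp_mul_left_iff
        (fun v : ℝ => -Real.log (1 - Real.exp (-v))) 0 hm').2 (by simpa using hi)
      exact this
    · have := integral_comp_mul_left_Ioi (fun v : ℝ => -Real.log (1 - Real.exp (-v))) 0 hm'
      rw [this, mul_zero, integral_neg_log_one_sub_exp_neg, smul_eq_mul]
      ring
  rw [setIntegral_congr_fun measurableSet_Ioi fun u hu => gapPhi_eq hk hu,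
    integral_sub (hm k hk).1 (hm (k + 1) (by omega)).1, (hm k hk).2, (hm (k + 1) (by omega)).2,
    gapConst]
  have : (k : ℝ) ≠ 0 := by positivity
  push_cast
  field_simp
  ring

lemma gapConst_pos {k : ℕ} (hk : 1 ≤ k) : 0 < gapConst k := by
  have : (0 : ℝ) < k := by exact_mod_cast hk
  rw [gapConst]
  positivity

/-- The region below the graph of `gapExp k`, sheared, is the region between `max 0 (-u)` and
the graph of `gapPhi k`. -/
lemma lintegral_gapExp {k : ℕ} (hk : 1 ≤ k) :
    ∫⁻ t in Set.Ioi (0 : ℝ), ENNReal.ofReal (gapExp k t) =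
      ∫⁻ u : ℝ, ENNReal.ofReal (gapPhi k |u|) := by
  have hc := (continuous_gapPhi hk).measurable
  let S : Set (ℝ × ℝ) := {p | 0 < p.1 + p.2 ∧ 0 < p.2 ∧ p.2 < gapPhi k p.1}
  have hS : MeasurableSet S := by
    refine MeasurableSet.inter ?_ (MeasurableSet.inter ?_ ?_)
    · exact measurableSet_lt measurable_const (measurable_fst.add measurable_snd)
    · exact measurableSet_lt measurable_const measurable_snd
    · exact measurableSet_lt measurable_snd (hc.comp measurable_fst)
  have hI : Measurable (S.indicator (1 : ℝ × ℝ → ENNReal)) := measurable_one.indicator hS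
  have h1 : ∫⁻ t in Set.Ioi (0 : ℝ), ENNReal.ofReal (gapExp k t) =
      ∫⁻ t : ℝ, ∫⁻ b : ℝ, S.indicator 1 (t - b, b) := by
    rw [← lintegral_indicator measurableSet_Ioi]
    refine lintegral_congr fun t => ?_
    by_cases ht : 0 < t
    · rw [Set.indicator_of_mem (Set.mem_Ioi.2 ht)]
      have : ∀ b : ℝ, S.indicator (1 : ℝ × ℝ → ENNReal) (t - b, b) =
          (Set.Ioo 0 (gapExp k t)).indicator 1 b := by
        intro b
        simp only [Set.indicator_apply]
        congr 1
        simp only [S, Set.mem_ofPred_eq, Set.mem_Ioo, sub_add_cancel, lt_gapExp_iff hk ht, ht,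
          true_and]
      simp_rw [this]
      rw [lintegral_indicator_one measurableSet_Ioo, Real.volume_Ioo, sub_zero]
    · rw [Set.indicator_of_notMem (fun h => ht (Set.mem_Ioi.1 h))]
      have : ∀ b : ℝ, S.indicator (1 : ℝ × ℝ → ENNReal) (t - b, b) = 0 := by
        intro b
        refine Set.indicator_of_notMem (fun h => ht ?_) _
        simpa using h.1
      simp [this]
  have h2 : ∀ b : ℝ, ∫⁻ t : ℝ, S.indicator (1 : ℝ × ℝ → ENNReal) (t - b, b) =
      ∫⁻ u : ℝ, S.indicator (1 : ℝ × ℝ → ENNReal) (u, b) := fun b =>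
    lintegral_sub_right_eq_self (fun u => S.indicator (1 : ℝ × ℝ → ENNReal) (u, b)) b
  rw [h1, lintegral_lintegral_swap]
  swap
  · exact (hI.comp ((measurable_fst.sub measurable_snd).prodMk measurable_snd)).aemeasurable
  simp_rw [h2]
  rw [lintegral_lintegral_swap]
  swap
  · exact (hI.comp measurable_swap).aemeasurable
  refine lintegral_congr fun u => ?_
  have : ∀ b : ℝ, S.indicator (1 : ℝ × ℝ → ENNReal) (u, b) =
      (Set.Ioo (max 0 (-u)) (gapPhi k u)).indicator 1 b := by
    intro b
    simp only [Set.indicator_apply]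
    congr 1
    simp only [S, Set.mem_ofPred_eq, Set.mem_Ioo, max_lt_iff, eq_iff_iff]
    constructor
    · rintro ⟨h1, h2, h3⟩; exact ⟨⟨h2, by linarith⟩, h3⟩
    · rintro ⟨⟨h2, h1⟩, h3⟩; exact ⟨by linarith, h2, h3⟩
  simp_rw [this]
  rw [lintegral_indicator_one measurableSet_Ioo, Real.volume_Ioo]
  congr 1
  -- For `u ≤ 0` the fibre has length `gapPhi k u + u = gapPhi k (-u)` by `gapPhi_neg`, so both
  -- half-lines contribute equally.
  rcases le_total 0 u with hu | hu
  · rw [abs_of_nonneg hu, max_eq_left (by linarith), sub_zero]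
  · rw [abs_of_nonpos hu, max_eq_right (by linarith), gapPhi_neg hk]
    ring

lemma integral_gapExp {k : ℕ} (hk : 1 ≤ k) :
    ∫ t in Set.Ioi (0 : ℝ), gapExp k t = gapConst k := by
  rw [integral_eq_lintegral_of_nonneg_ae (Eventually.of_forall fun t => (gapExp_pos hk t).le)
    (aemeasurable_restrict_of_antitoneOn measurableSet_Ioi
      (gapExp_antitoneOn hk)).aestronglyMeasurable, lintegral_gapExp hk,
    ← integral_eq_lintegral_of_nonneg_ae (Eventually.of_forall fun t => (gapPhi_pos hk _).le)
      ((continuous_gapPhi hk).comp continuous_abs).aestronglyMeasurable,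
    integral_comp_abs (f := gapPhi k), integral_gapPhi hk]
  ring

lemma integrableOn_gapExp {k : ℕ} (hk : 1 ≤ k) : IntegrableOn (gapExp k) (Set.Ioi 0) := by
  refine Integrable.of_integral_ne_zero ?_
  rw [integral_gapExp hk]
  exact (gapConst_pos hk).ne'

/-! ### Comparison of the sum of `gapExp k (l s)` with the integral. -/

lemma intervalIntegrable_gapExp {k : ℕ} (hk : 1 ≤ k) {a b : ℝ} (ha : 0 ≤ a) (hab : a ≤ b) :
    IntervalIntegrable (gapExp k) volume a b := by
  rw [intervalIntegrable_iff_integrableOn_Ioc_of_le hab]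
  exact (integrableOn_gapExp hk).mono_set fun x hx => ha.trans_lt hx.1

lemma mul_gapExp_le_integral {k : ℕ} (hk : 1 ≤ k) {a b : ℝ} (ha : 0 ≤ a) (hab : a < b) :
    (b - a) * gapExp k b ≤ ∫ t in a..b, gapExp k t := by
  have h := intervalIntegral.integral_mono_on_of_le_Ioo hab.le
    (intervalIntegrable_const (c := gapExp k b)) (intervalIntegrable_gapExp hk ha hab.le)
    (fun x hx => gapExp_antitoneOn hk (Set.mem_Ioi.2 (ha.trans_lt hx.1))
      (Set.mem_Ioi.2 (ha.trans_lt hab)) hx.2.le)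
  simpa using h

/-- The chord of a convex function lies above its graph. The weight `1/2` at the endpoint is what
later produces the factor `s ^ (-1 / (2 k))`; monotonicity alone would only give `s ^ (-1 / k)`. -/
lemma integral_gapExp_le_trapezoid {k : ℕ} (hk : 1 ≤ k) {a b : ℝ} (ha : 0 < a) (hab : a < b) :
    ∫ t in a..b, gapExp k t ≤ (b - a) * ((gapExp k a + gapExp k b) / 2) := by
  have hba : 0 < b - a := sub_pos.2 hab
  have h := intervalIntegral.integral_mono_on hab.le (intervalIntegrable_gapExp hk ha.le hab.le)
    (g := fun x => gapExp k a + (x - a) * ((gapExp k b - gapExp k a) / (b - a)))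
    (Continuous.intervalIntegrable (by fun_prop) _ _) (fun x hx => by
      have := (convexOn_gapExp hk).2 (Set.mem_Ioi.2 ha) (Set.mem_Ioi.2 (ha.trans hab))
        (div_nonneg (sub_nonneg.2 hx.2) hba.le) (div_nonneg (sub_nonneg.2 hx.1) hba.le)
        (by field_simp; ring)
      simp only [smul_eq_mul] at this
      have e : (b - x) / (b - a) * a + (x - a) / (b - a) * b = x := by field_simp; ring
      rw [e] at this
      refine this.trans_eq ?_
      field_simp
      ring)
  refine h.trans_eq ?_
  rw [intervalIntegral.integral_add (by simp) (Continuous.intervalIntegrable (by fun_prop) _ _),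
    intervalIntegral.integral_mul_const, intervalIntegral.integral_sub (by simp) (by simp)]
  simp only [intervalIntegral.integral_const, integral_id, smul_eq_mul]
  field_simp
  ring

lemma integral_gapExp_le {k : ℕ} (hk : 1 ≤ k) {b : ℝ} (hb : 0 ≤ b) :
    ∫ t in (0 : ℝ)..b, gapExp k t ≤ gapConst k := by
  rw [intervalIntegral.integral_of_le hb, ← integral_gapExp hk]
  exact setIntegral_mono_set (integrableOn_gapExp hk)
    (Eventually.of_forall fun t => (gapExp_pos hk t).le)
    (Eventually.of_forall fun x hx => hx.1)

lemma sum_gapExp_le_integral {k : ℕ} (hk : 1 ≤ k) {s : ℝ} (hs : 0 < s) (N : ℕ) :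
    s * ∑ n ∈ Finset.range N, gapExp k (((1 + n : ℕ) : ℝ) * s) ≤
      ∫ t in (0 : ℝ)..(N * s), gapExp k t := by
  induction N with
  | zero => simp
  | succ N ih =>
    have hN : (0 : ℝ) ≤ N * s := by positivity
    have hN1 : (N : ℝ) * s < ((N + 1 : ℕ) : ℝ) * s := by push_cast; linarith
    have h := mul_gapExp_le_integral hk hN hN1
    rw [← intervalIntegral.integral_add_adjacent_intervals
      (intervalIntegrable_gapExp hk le_rfl hN) (intervalIntegrable_gapExp hk hN hN1.le),
      Finset.sum_range_succ, mul_add, add_comm 1 N]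
    refine add_le_add ih (le_trans (le_of_eq ?_) h)
    push_cast
    ring

lemma sum_gapExp_le {k : ℕ} (hk : 1 ≤ k) {s : ℝ} (hs : 0 < s) (N : ℕ) :
    ∑ n ∈ Finset.range N, gapExp k (((1 + n : ℕ) : ℝ) * s) ≤ gapConst k / s := by
  rw [le_div_iff₀ hs, mul_comm]
  exact (sum_gapExp_le_integral hk hs N).trans (integral_gapExp_le hk (by positivity))

/-- The tail sum `∑_{l ≥ n} gapExp k (l s)`. -/
noncomputable def gapTail (k : ℕ) (s : ℝ) (n : ℕ) : ℝ :=
  ∑' j : ℕ, gapExp k (((n + j : ℕ) : ℝ) * s)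

lemma summable_gapExp {k : ℕ} (hk : 1 ≤ k) {s : ℝ} (hs : 0 < s) (n : ℕ) :
    Summable fun j : ℕ => gapExp k (((n + j : ℕ) : ℝ) * s) := by
  have h1 : Summable fun j : ℕ => gapExp k (((1 + j : ℕ) : ℝ) * s) :=
    summable_of_sum_range_le (fun _ => (gapExp_pos hk _).le) (sum_gapExp_le hk hs)
  have h0 : Summable fun j : ℕ => gapExp k (((j : ℕ) : ℝ) * s) := by
    refine (summable_nat_add_iff 1).1 ?_
    simpa only [add_comm 1] using h1
  simpa only [add_comm n] using (summable_nat_add_iff n).2 h0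

lemma gapTail_one_le {k : ℕ} (hk : 1 ≤ k) {s : ℝ} (hs : 0 < s) :
    gapTail k s 1 ≤ gapConst k / s :=
  Real.tsum_le_of_sum_range_le (fun _ => (gapExp_pos hk _).le) (sum_gapExp_le hk hs)

lemma gapTail_nonneg {k : ℕ} (hk : 1 ≤ k) (s : ℝ) (n : ℕ) : 0 ≤ gapTail k s n :=
  tsum_nonneg fun _ => (gapExp_pos hk _).le

lemma gapTail_eq_add {k : ℕ} (hk : 1 ≤ k) {s : ℝ} (hs : 0 < s) (n : ℕ) :
    gapTail k s n = gapExp k (n * s) + gapTail k s (n + 1) := by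
  rw [gapTail, (summable_gapExp hk hs n).tsum_eq_zero_add, gapTail]
  simp only [add_zero, add_assoc, add_comm 1]

lemma gapTail_eq_sum_add {k : ℕ} (hk : 1 ≤ k) {s : ℝ} (hs : 0 < s) (n N : ℕ) :
    gapTail k s n =
      ∑ j ∈ Finset.range N, gapExp k (((n + j : ℕ) : ℝ) * s) + gapTail k s (n + N) := by
  induction N with
  | zero => simp
  | succ N ih => rw [Finset.sum_range_succ, ih, gapTail_eq_add hk hs (n + N), add_assoc n N 1]; ring

lemma tendsto_gapTail (k : ℕ) (s : ℝ) :
    Tendsto (gapTail k s) atTop (𝓝 0) := by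
  have h := tendsto_sum_nat_add fun j : ℕ => gapExp k ((j : ℝ) * s)
  refine h.congr fun n => ?_
  simp_rw [gapTail, add_comm n]

lemma integral_gapExp_le_sum {k : ℕ} (hk : 1 ≤ k) {s : ℝ} (hs : 0 < s) {N : ℕ} (hN : 1 ≤ N)
    (m : ℕ) :
    ∫ t in (N * s : ℝ)..((N + m : ℕ) * s), gapExp k t ≤
      s * (∑ j ∈ Finset.range m, gapExp k (((N + 1 + j : ℕ) : ℝ) * s) + gapExp k (N * s) / 2 -
        gapExp k (((N + m : ℕ) : ℝ) * s) / 2) := by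
  induction m with
  | zero => simp
  | succ m ih =>
    have h0 : (0 : ℝ) < N := by exact_mod_cast hN
    have h1 : (N : ℝ) * s ≤ ((N + m : ℕ) : ℝ) * s := by push_cast; nlinarith [m.cast_nonneg (α := ℝ)]
    have hp : 0 < (N : ℝ) * s := by positivity
    have h2 : ((N + m : ℕ) : ℝ) * s < ((N + (m + 1) : ℕ) : ℝ) * s := by push_cast; nlinarith
    have h := integral_gapExp_le_trapezoid hk (hp.trans_le h1) h2
    rw [← intervalIntegral.integral_add_adjacent_intervals
      (intervalIntegrable_gapExp hk hp.le h1)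
      (intervalIntegrable_gapExp hk (hp.le.trans h1) h2.le), Finset.sum_range_succ]
    have e : N + 1 + m = N + (m + 1) := by ring
    have e2 : ((N + (m + 1) : ℕ) : ℝ) * s - ((N + m : ℕ) : ℝ) * s = s := by push_cast; ring
    rw [e2] at h
    rw [e]
    linarith

lemma gapConst_sub_integral_le {k : ℕ} (hk : 1 ≤ k) {s : ℝ} (hs : 0 < s) {N : ℕ} (hN : 1 ≤ N) :
    gapConst k - ∫ t in (0 : ℝ)..(N * s), gapExp k t ≤
      s * (gapTail k s (N + 1) + gapExp k (N * s) / 2) := by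
  have hlim : Tendsto (fun m : ℕ => ∫ t in (0 : ℝ)..(((N + m : ℕ) : ℝ) * s), gapExp k t) atTop
      (𝓝 (gapConst k)) := by
    rw [← integral_gapExp hk]
    refine intervalIntegral_tendsto_integral_Ioi 0 (integrableOn_gapExp hk) ?_
    refine Tendsto.atTop_mul_const hs (tendsto_natCast_atTop_atTop.comp ?_)
    exact tendsto_atTop_mono (fun m => Nat.le_add_left m N) tendsto_id
  refine le_of_tendsto (hlim.sub_const _) (Eventually.of_forall fun m => ?_)
  have hp : 0 ≤ (N : ℝ) * s := by positivity
  have h1 : (N : ℝ) * s ≤ ((N + m : ℕ) : ℝ) * s := by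
    push_cast; nlinarith [m.cast_nonneg (α := ℝ)]
  have h := integral_gapExp_le_sum hk hs hN m
  rw [intervalIntegral.integral_interval_sub_left
    (intervalIntegrable_gapExp hk le_rfl (hp.trans h1)) (intervalIntegrable_gapExp hk le_rfl hp)]
  refine h.trans (mul_le_mul_of_nonneg_left ?_ hs.le)
  have h2 := (summable_gapExp hk hs (N + 1)).sum_le_tsum (Finset.range m)
    (fun _ _ => (gapExp_pos hk _).le)
  have h3 := gapExp_pos hk (((N + m : ℕ) : ℝ) * s)
  rw [gapTail]
  linarith

/-! ### Behaviour of `gapExp` at `0` and the refined bound for the sum. -/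

/-- With `y` the root and `f = exp (-gapExp k t)`, one has `exp (-t) = y f` and `1 - f = y ^ k (1 -
exp (-t))`. Near `t = 0` the identity says `f ^ k ~ t`. -/
lemma exp_neg_gapExp_pow {k : ℕ} (hk : 1 ≤ k) {t : ℝ} (ht : 0 < t) :
    Real.exp (-gapExp k t) ^ k * (1 - Real.exp (-gapExp k t)) =
      Real.exp (-t) ^ k * (1 - Real.exp (-t)) := by
  have hr := root_pos hk ht
  have hg := (geom_pos (m := k + 1) (by omega) hr.le).ne'
  have h : 1 - Real.exp (-gapExp k t) = root k t ^ k / geom (k + 1) (root k t) := by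
    rw [exp_neg_gapExp hk ht, geom_succ] at *
    field_simp
    ring
  rw [h, one_sub_exp_neg_eq hk ht, ← root_mul_exp_neg_gapExp hk ht, mul_pow]
  ring

lemma mul_gapExp_add_log_le {k : ℕ} (hk : 1 ≤ k) {t : ℝ} (ht : 0 < t) :
    k * gapExp k t + Real.log t ≤ (k + 1) * t := by
  have h1 : t * Real.exp (-t) ≤ 1 - Real.exp (-t) := by
    have h := Real.add_one_le_exp t
    have h2 : Real.exp t * Real.exp (-t) = 1 := by rw [← Real.exp_add]; simp
    nlinarith [Real.exp_pos (-t)]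
  have h3 : Real.exp (-t) ^ k * (t * Real.exp (-t)) ≤ Real.exp (-gapExp k t) ^ k := by
    calc _ ≤ Real.exp (-t) ^ k * (1 - Real.exp (-t)) := by gcongr
      _ = Real.exp (-gapExp k t) ^ k * (1 - Real.exp (-gapExp k t)) :=
          (exp_neg_gapExp_pow hk ht).symm
      _ ≤ Real.exp (-gapExp k t) ^ k * 1 := by
          gcongr; linarith [Real.exp_pos (-gapExp k t)]
      _ = _ := mul_one _
  have h4 := Real.log_le_log (by positivity) h3
  rw [Real.log_mul (by positivity) (by positivity), Real.log_mul ht.ne' (by positivity),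
    Real.log_pow, Real.log_pow, Real.log_exp, Real.log_exp] at h4
  linarith

lemma log_le_mul_gapExp_add_log {k : ℕ} (hk : 1 ≤ k) {t : ℝ} (ht : 0 < t) :
    Real.log (1 - Real.exp (-gapExp k t)) ≤ k * gapExp k t + Real.log t := by
  have hp := one_sub_exp_neg_pos (gapExp_pos hk t)
  have h1 : Real.exp (-gapExp k t) ^ k * (1 - Real.exp (-gapExp k t)) ≤ t := by
    rw [exp_neg_gapExp_pow hk ht]
    have h := Real.add_one_le_exp (-t)
    have h2 : Real.exp (-t) ^ k ≤ 1 :=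
      pow_le_one₀ (Real.exp_pos _).le (Real.exp_le_one_iff.2 (by linarith))
    have h3 := one_sub_exp_neg_pos ht
    nlinarith
  have h4 := Real.log_le_log (by positivity) h1
  rw [Real.log_mul (by positivity) hp.ne', Real.log_pow, Real.log_exp] at h4
  linarith

/-- The lower bound in `log_le_mul_gapExp_add_log` involves `gapExp` itself; by monotonicity its
value at `t = 1` gives a constant that serves on `(0, 1)`. -/
lemma tendsto_gapExp_atTop {k : ℕ} (hk : 1 ≤ k) :
    Tendsto (gapExp k) (𝓝[>] 0) atTop := by
  have hk' : (0 : ℝ) < k := by exact_mod_cast hk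
  set c := Real.log (1 - Real.exp (-gapExp k 1))
  have h : Tendsto (fun t => (c + -Real.log t) / k) (𝓝[>] 0) atTop :=
    (tendsto_atTop_add_const_left _ c
      (tendsto_neg_atBot_atTop.comp Real.tendsto_log_nhdsGT_zero)).atTop_div_const hk'
  refine tendsto_atTop_mono' _ ?_ h
  filter_upwards [Ioo_mem_nhdsGT (zero_lt_one (α := ℝ))] with t ht
  rw [div_le_iff₀ hk']
  have h1 := log_le_mul_gapExp_add_log hk ht.1
  have h2 : c ≤ Real.log (1 - Real.exp (-gapExp k t)) := by
    refine Real.log_le_log (one_sub_exp_neg_pos (gapExp_pos hk 1)) ?_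
    have := gapExp_antitoneOn hk (Set.mem_Ioi.2 ht.1) (Set.mem_Ioi.2 zero_lt_one) ht.2.le
    have := Real.exp_le_exp.2 (neg_le_neg this)
    linarith
  linarith

lemma tendsto_mul_gapExp_add_log {k : ℕ} (hk : 1 ≤ k) :
    Tendsto (fun t => k * gapExp k t + Real.log t) (𝓝[>] 0) (𝓝 0) := by
  have h1 : Tendsto (fun t => Real.log (1 - Real.exp (-gapExp k t))) (𝓝[>] 0) (𝓝 0) := by
    have h := Real.tendsto_exp_neg_atTop_nhds_zero.comp (tendsto_gapExp_atTop hk)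
    have h2 := (h.const_sub 1).log (by norm_num)
    simpa [Function.comp_def] using h2
  have h2 : Tendsto (fun t : ℝ => ((k : ℝ) + 1) * t) (𝓝[>] 0) (𝓝 0) := by
    have : Tendsto (fun t : ℝ => ((k : ℝ) + 1) * t) (𝓝 0) (𝓝 (((k : ℝ) + 1) * 0)) :=
      tendsto_id.const_mul _
    rw [mul_zero] at this
    exact this.mono_left nhdsWithin_le_nhds
  refine tendsto_of_tendsto_of_tendsto_of_le_of_le' h1 h2 ?_ ?_
  · filter_upwards [self_mem_nhdsWithin] with t ht using log_le_mul_gapExp_add_log hk ht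
  · filter_upwards [self_mem_nhdsWithin] with t ht using mul_gapExp_add_log_le hk ht

lemma mul_integral_gapExp_le {k : ℕ} (hk : 1 ≤ k) {b : ℝ} (hb : 0 < b) :
    k * ∫ t in (0 : ℝ)..b, gapExp k t ≤ (k + 1) * b ^ 2 / 2 - b * Real.log b + b := by
  have hlog : IntervalIntegrable Real.log volume 0 b := intervalIntegral.intervalIntegrable_log'
  have hlin : IntervalIntegrable (fun t : ℝ => ((k : ℝ) + 1) * t) volume 0 b :=
    Continuous.intervalIntegrable (by fun_prop) _ _
  have h := intervalIntegral.integral_mono_on_of_le_Ioo hb.le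
    ((intervalIntegrable_gapExp hk le_rfl hb.le).const_mul k) (hlin.sub hlog)
    (fun t ht => by have := mul_gapExp_add_log_le hk ht.1; linarith)
  rw [intervalIntegral.integral_const_mul, intervalIntegral.integral_sub hlin hlog,
    intervalIntegral.integral_const_mul, integral_id, integral_log] at h
  refine h.trans_eq ?_
  simp
  ring

/-- The upper bound for `exp (-∑_{l ≥ 1} gapExp k (l s))`, in logarithmic form. -/
lemma neg_gapTail_one_le {k : ℕ} (hk : 1 ≤ k) {N : ℕ} (hN : 1 ≤ N) :
    ∃ η : ℝ → ℝ, Tendsto η (𝓝[>] 0) (𝓝 0) ∧ ∀ s : ℝ, 0 < s →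
      -gapTail k s 1 ≤ -(gapConst k / s) - Real.log s / (2 * k) +
        (Real.log (N.factorial) + N - (N + 1 / 2) * Real.log N + η s) / k := by
  have hk' : (0 : ℝ) < k := by exact_mod_cast hk
  have hN' : (0 : ℝ) < N := by exact_mod_cast hN
  set δ : ℝ → ℝ := fun t => k * gapExp k t + Real.log t with hδ
  have hδl : ∀ l : ℕ, 1 ≤ l → Tendsto (fun s : ℝ => δ (l * s)) (𝓝[>] 0) (𝓝 0) := by
    intro l hl
    have hl' : (0 : ℝ) < l := by exact_mod_cast hl
    refine (tendsto_mul_gapExp_add_log hk).comp (tendsto_nhdsWithin_iff.2 ⟨?_, ?_⟩)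
    · have : Tendsto (fun s : ℝ => (l : ℝ) * s) (𝓝 0) (𝓝 ((l : ℝ) * 0)) :=
        tendsto_id.const_mul _
      rw [mul_zero] at this
      exact this.mono_left nhdsWithin_le_nhds
    · filter_upwards [self_mem_nhdsWithin] with s hs using mul_pos hl' hs
  -- The first `N` terms are `-log (l s) / k` up to `δ`, which yields `log N!`; the later ones are
  -- bounded by the trapezoid rule. The last summand is the error of `mul_integral_gapExp_le` at `b
  -- = N s`, divided by `s`.
  refine ⟨fun s => -∑ j ∈ Finset.range N, δ (((1 + j : ℕ) : ℝ) * s) + δ (N * s) / 2 +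
    (k + 1) * N ^ 2 * s / 2, ?_, ?_⟩
  · have h1 := tendsto_finsetSum (Finset.range N) fun j _ => hδl (1 + j) (by omega)
    have h2 : Tendsto (fun s : ℝ => ((k : ℝ) + 1) * N ^ 2 * s / 2) (𝓝[>] 0) (𝓝 0) := by
      have : Tendsto (fun s : ℝ => ((k : ℝ) + 1) * N ^ 2 * s / 2) (𝓝 0)
        (𝓝 (((k : ℝ) + 1) * N ^ 2 * 0 / 2)) := (tendsto_id.const_mul _).div_const _
      rw [mul_zero, zero_div] at this
      exact this.mono_left nhdsWithin_le_nhds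
    simpa using (h1.neg.add ((hδl N hN).div_const 2)).add h2
  · intro s hs
    have hlog : ∑ j ∈ Finset.range N, Real.log (((1 + j : ℕ) : ℝ) * s) =
        Real.log N.factorial + N * Real.log s := by
      rw [← Finset.prod_range_add_one_eq_factorial, Nat.cast_prod, Real.log_prod
        (fun j _ => by positivity), Finset.sum_congr rfl fun j _ => Real.log_mul (by positivity)
        hs.ne', Finset.sum_add_distrib, Finset.sum_const, Finset.card_range, nsmul_eq_mul]
      simp only [add_comm 1]
    have h1 := gapConst_sub_integral_le hk hs hN
    have h2 := mul_integral_gapExp_le hk (mul_pos hN' hs)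
    have h3 := gapTail_eq_sum_add hk hs 1 N
    rw [add_comm 1 N] at h3
    have h4 : ∑ j ∈ Finset.range N, δ (((1 + j : ℕ) : ℝ) * s) =
        k * ∑ j ∈ Finset.range N, gapExp k (((1 + j : ℕ) : ℝ) * s) +
          (Real.log N.factorial + N * Real.log s) := by
      rw [← hlog, Finset.mul_sum, ← Finset.sum_add_distrib]
    have h5 : Real.log (N * s) = Real.log N + Real.log s := Real.log_mul hN'.ne' hs.ne'
    have h6 : δ (N * s) = k * gapExp k (N * s) + Real.log (N * s) := rfl
    have h7 : gapConst k / s - (gapTail k s (N + 1) + gapExp k (N * s) / 2) ≤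
        (((k + 1) * (N * s) ^ 2 / 2 - N * s * Real.log (N * s) + N * s) / k) / s := by
      rw [le_div_iff₀ hs, le_div_iff₀ hk', sub_mul, div_mul_cancel₀ _ hs.ne']
      nlinarith
    have h8 : (((k + 1) * (N * s) ^ 2 / 2 - N * s * Real.log (N * s) + N * s) / k) / s =
        ((k + 1) * N ^ 2 * s / 2 - N * Real.log (N * s) + N) / k := by
      field_simp
    rw [h8] at h7
    simp only
    rw [h4, h6, h5]
    rw [h5] at h7
    rw [h3, ← sub_nonneg]
    have := sub_nonneg.2 h7
    refine this.trans_eq ?_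
    field_simp
    ring

/-! ### The recursion and its sub- and supersolutions. -/

/-- The probability that, among independent trials `n, n + 1, …, n + m - 1` where trial `l` fails
with probability `exp (-l s)`, there are neither `r` failures at the start nor `k` consecutive
failures elsewhere. -/
noncomputable def runProb (k : ℕ) (s : ℝ) : ℕ → ℕ → ℕ → ℝ
  | _, _, 0 => 0
  | 0, _, _ + 1 => 1
  | m + 1, n, r + 1 => (1 - Real.exp (-(n * s))) * runProb k s m (n + 1) k +
      Real.exp (-(n * s)) * runProb k s m (n + 1) r

@[simp] lemma runProb_right_zero (k : ℕ) (s : ℝ) (m n : ℕ) : runProb k s m n 0 = 0 := by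
  cases m <;> simp [runProb]

lemma runProb_succ_succ (k : ℕ) (s : ℝ) (m n r : ℕ) :
    runProb k s (m + 1) n (r + 1) = (1 - Real.exp (-(n * s))) * runProb k s m (n + 1) k +
      Real.exp (-(n * s)) * runProb k s m (n + 1) r := by
  rw [runProb]

lemma one_sub_exp_neg_nonneg {t : ℝ} (ht : 0 ≤ t) : 0 ≤ 1 - Real.exp (-t) :=
  sub_nonneg.2 (Real.exp_le_one_iff.2 (neg_nonpos.2 ht))

section bounds

variable {k : ℕ} {s : ℝ}

lemma runProb_nonneg (hs : 0 ≤ s) (m n r : ℕ) : 0 ≤ runProb k s m n r := by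
  induction m generalizing n r with
  | zero => cases r <;> simp [runProb]
  | succ m ih =>
    cases r with
    | zero => simp
    | succ r =>
      rw [runProb_succ_succ]
      have := one_sub_exp_neg_nonneg (t := n * s) (by positivity)
      have := ih (n + 1) k
      have := ih (n + 1) r
      positivity

lemma runProb_le_one (hs : 0 ≤ s) (m n r : ℕ) : runProb k s m n r ≤ 1 := by
  induction m generalizing n r with
  | zero => cases r <;> simp [runProb]
  | succ m ih =>
    cases r with
    | zero => simp
    | succ r =>
      rw [runProb_succ_succ]
      have := one_sub_exp_neg_nonneg (t := n * s) (by positivity)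
      have := mul_le_mul_of_nonneg_left (ih (n + 1) k) this
      have := mul_le_mul_of_nonneg_left (ih (n + 1) r) (Real.exp_pos (-(n * s))).le
      linarith

lemma runProb_antitone (hs : 0 ≤ s) (n r : ℕ) : Antitone fun m => runProb k s m n r := by
  refine antitone_nat_of_succ_le fun m => ?_
  induction m generalizing n r with
  | zero =>
    cases r with
    | zero => simp
    | succ r =>
      have := runProb_le_one (k := k) hs 1 n (r + 1)
      simpa [runProb] using this
  | succ m ih =>
    cases r with
    | zero => simp
    | succ r =>
      rw [runProb_succ_succ, runProb_succ_succ]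
      have := one_sub_exp_neg_nonneg (t := n * s) (by positivity)
      have := mul_le_mul_of_nonneg_left (ih (n + 1) k) this
      have := mul_le_mul_of_nonneg_left (ih (n + 1) r) (Real.exp_pos (-(n * s))).le
      linarith

/-- The eigenvector equation of the frozen recursion: a success resets the allowance to `k`, where
the vector equals `1`, and a failure lowers it by one. -/
lemma exp_neg_gapExp_mul (hk : 1 ≤ k) {t : ℝ} (ht : 0 < t) (r : ℕ) :
    Real.exp (-gapExp k t) * (geom (r + 1) (root k t) / geom k (root k t)) =
      (1 - Real.exp (-t)) + Real.exp (-t) * (geom r (root k t) / geom k (root k t)) := by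
  have hr := root_pos hk ht
  have h1 := (geom_pos hk hr.le).ne'
  have h2 := (geom_pos (m := k + 1) (by omega) hr.le).ne'
  rw [one_sub_exp_neg_eq hk ht, ← root_mul_exp_neg_gapExp hk ht, exp_neg_gapExp hk ht,
    geom_succ' r]
  field_simp

lemma le_runProb (hk : 1 ≤ k) (hs : 0 < s) (m : ℕ) {n r : ℕ} (hn : 1 ≤ n) (hr : r ≤ k) :
    Real.exp (-gapTail k s n) * (geom r (root k (n * s)) / geom k (root k (n * s))) ≤
      runProb k s m n r := by
  have ht : ∀ n : ℕ, 1 ≤ n → 0 < (n : ℝ) * s := fun n hn =>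
    mul_pos (by exact_mod_cast hn) hs
  induction m generalizing n r with
  | zero =>
    cases r with
    | zero => simp
    | succ r =>
      have h1 : Real.exp (-gapTail k s n) ≤ 1 :=
        Real.exp_le_one_iff.2 (neg_nonpos.2 (gapTail_nonneg hk s n))
      have hp := (root_pos hk (ht n hn)).le
      rw [runProb]
      exact mul_le_one₀ h1 (div_nonneg (geom_nonneg _ hp) (geom_nonneg _ hp))
        (div_le_one_of_le₀ (geom_mono_left hr hp) (geom_nonneg _ hp))
  | succ m ih =>
    cases r with
    | zero => simp
    | succ r =>
      have hn1 : 1 ≤ n + 1 := by omega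
      have i1 := ih hn1 le_rfl
      have i2 := ih hn1 (show r ≤ k by omega)
      rw [div_self (geom_pos hk (root_pos hk (ht _ hn1)).le).ne', mul_one] at i1
      have hd : geom r (root k (n * s)) / geom k (root k (n * s)) ≤
          geom r (root k ((n + 1 : ℕ) * s)) / geom k (root k ((n + 1 : ℕ) * s)) :=
        geom_div_geom_antitone hk (by omega) (root_pos hk (ht _ hn1)).le
          (root_anti hk (ht n hn) (by push_cast; nlinarith))
      have hp := one_sub_exp_neg_nonneg (ht n hn).le
      have hx := Real.exp_pos (-((n : ℝ) * s))
      have hE := Real.exp_pos (-gapTail k s (n + 1))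
      rw [runProb_succ_succ, gapTail_eq_add hk hs n, neg_add, Real.exp_add, mul_right_comm,
        exp_neg_gapExp_mul hk (ht n hn)]
      have j1 := mul_le_mul_of_nonneg_left i1 hp
      have j2 := mul_le_mul_of_nonneg_left i2 hx.le
      have j3 := mul_le_mul_of_nonneg_left hd (mul_pos hE hx).le
      linarith

/-- A failure replaces `(n, r + 1)` by `(n + 1, r)`, which keeps the same evaluation point `n + r`;
this is the reason for that shift. The exponential prefactor pays for the jump of the evaluation
point after a success. The number `δ` handles the terminal condition, where `runProb` is `1`. -/
lemma runProb_le (hk : 1 ≤ k) (hs : 0 < s) {δ : ℝ} (m : ℕ) {n r : ℕ} (hn : 1 ≤ n)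
    (hr : r + 1 ≤ k)
    (hδ : ∀ z, n + m ≤ z → δ ≤ Real.exp (-gapTail k s z) / geom k (root k (z * s))) :
    δ * runProb k s m n (r + 1) ≤
      Real.exp ((k - (r + 1 : ℕ)) * gapExp k ((n + r : ℕ) * s)) *
        (geom (r + 1) (root k ((n + r : ℕ) * s)) / geom k (root k ((n + r : ℕ) * s))) *
        Real.exp (-gapTail k s (n + r)) := by
  have ht : ∀ n : ℕ, 1 ≤ n → 0 < (n : ℝ) * s := fun n hn =>
    mul_pos (by exact_mod_cast hn) hs
  induction m generalizing n r with
  | zero =>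
    have hp := (root_pos hk (ht (n + r) (by omega))).le
    have hg := geom_pos hk hp
    have h1 : 1 ≤ Real.exp ((k - (r + 1 : ℕ)) * gapExp k ((n + r : ℕ) * s)) := by
      refine Real.one_le_exp (mul_nonneg (sub_nonneg.2 (by exact_mod_cast hr)) (gapExp_pos hk _).le)
    rw [runProb, mul_one]
    refine (hδ (n + r) (by omega)).trans ?_
    rw [div_eq_inv_mul]
    refine mul_le_mul_of_nonneg_right ?_ (Real.exp_pos _).le
    calc _ ≤ 1 * (geom (r + 1) (root k ((n + r : ℕ) * s)) / geom k (root k ((n + r : ℕ) * s))) := by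
          rw [one_mul, inv_eq_one_div]
          gcongr
          exact one_le_geom (by omega) hp
      _ ≤ _ := mul_le_mul_of_nonneg_right h1 (div_nonneg (geom_nonneg _ hp) hg.le)
  | succ m ih =>
    obtain ⟨k', rfl⟩ : ∃ l, k = l + 1 := ⟨k - 1, by omega⟩
    set k := k' + 1 with hkk
    have hδ' : ∀ z, n + 1 + m ≤ z → δ ≤ Real.exp (-gapTail k s z) / geom k (root k (z * s)) :=
      fun z hz => hδ z (by omega)
    have i1 := ih (n := n + 1) (r := k') (by omega) le_rfl hδ'
    have hz := ht (n + r) (by omega)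
    have hp := (root_pos hk hz).le
    have hg := geom_pos hk hp
    set z := n + r with hzz
    set D := fun r => geom r (root k (z * s)) / geom k (root k (z * s)) with hD
    set E := Real.exp ((k - r) * gapExp k (z * s)) * Real.exp (-gapTail k s z) with hE
    have hE0 : 0 < E := by positivity
    -- A success moves the evaluation point from `z` to `z + (k - r)`; each of the `k - r` tail
    -- terms skipped is at most `gapExp k (z * s)`.
    have i1' : δ * runProb k s m (n + 1) k ≤ E := by
      refine i1.trans ?_
      have e : n + 1 + k' = z + (k - r) := by omega
      rw [div_self (geom_pos hk (root_pos hk (ht _ (by omega))).le).ne', sub_self, zero_mul,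
        Real.exp_zero, one_mul, one_mul, e, hE, ← Real.exp_add, Real.exp_le_exp,
        gapTail_eq_sum_add hk hs z (k - r)]
      have h := Finset.sum_le_card_nsmul (Finset.range (k - r))
        (fun j => gapExp k (((z + j : ℕ) : ℝ) * s)) (gapExp k (z * s)) (fun j _ =>
          gapExp_antitoneOn hk (Set.mem_Ioi.2 hz) (Set.mem_Ioi.2 (ht _ (by omega)))
            (mul_le_mul_of_nonneg_right (by exact_mod_cast Nat.le_add_right z j) hs.le))
      rw [Finset.card_range, nsmul_eq_mul, Nat.cast_sub (by omega)] at h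
      linarith
    have i2 : δ * runProb k s m (n + 1) r ≤ E * D r := by
      cases r with
      | zero => simp [hD]
      | succ r =>
        have i := ih (n := n + 1) (r := r) (by omega) (by omega) hδ'
        rw [show n + 1 + r = z by omega] at i
        refine i.trans_eq ?_
        rw [hE, hD]
        ring
    have hD1 : D r ≤ 1 := div_le_one_of_le₀ (geom_mono_left (by omega) hp) hg.le
    have hxz : Real.exp (-((z : ℝ) * s)) ≤ Real.exp (-((n : ℝ) * s)) := by
      have : (n : ℝ) ≤ z := by exact_mod_cast Nat.le_add_right n r
      rw [Real.exp_le_exp]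
      nlinarith
    have hpn := one_sub_exp_neg_nonneg (ht n hn).le
    have hx := Real.exp_pos (-((n : ℝ) * s))
    calc δ * runProb k s (m + 1) n (r + 1)
        = (1 - Real.exp (-(n * s))) * (δ * runProb k s m (n + 1) k) +
            Real.exp (-(n * s)) * (δ * runProb k s m (n + 1) r) := by
          rw [runProb_succ_succ]; ring
      _ ≤ (1 - Real.exp (-(n * s))) * E + Real.exp (-(n * s)) * (E * D r) := by gcongr
      -- Trial `z` succeeds at least as often as trial `n`, and success carries the larger weight
      -- because `D r ≤ 1`.
      _ ≤ E * ((1 - Real.exp (-(z * s))) + Real.exp (-(z * s)) * D r) := by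
          have := mul_nonneg hE0.le (mul_nonneg (sub_nonneg.2 hxz) (sub_nonneg.2 hD1))
          linarith
      _ = E * (Real.exp (-gapExp k (z * s)) * D (r + 1)) := by rw [hD, exp_neg_gapExp_mul hk hz]
      _ = _ := by
          have : Real.exp ((k - (r + 1 : ℕ)) * gapExp k (z * s)) =
              Real.exp ((k - r) * gapExp k (z * s)) * Real.exp (-gapExp k (z * s)) := by
            rw [← Real.exp_add]
            congr 1
            push_cast
            ring
          rw [this, hE]
          ring

/-- The limit of `runProb k s m n r` as `m → ∞`. -/
noncomputable def limRunProb (k : ℕ) (s : ℝ) (n r : ℕ) : ℝ := ⨅ m, runProb k s m n r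

lemma bddBelow_runProb (hs : 0 ≤ s) (n r : ℕ) :
    BddBelow (Set.range fun m => runProb k s m n r) :=
  ⟨0, by rintro _ ⟨m, rfl⟩; exact runProb_nonneg hs m n r⟩

lemma tendsto_runProb (hs : 0 ≤ s) (n r : ℕ) :
    Tendsto (fun m => runProb k s m n r) atTop (𝓝 (limRunProb k s n r)) :=
  tendsto_atTop_ciInf (runProb_antitone hs n r) (bddBelow_runProb hs n r)

/-- Split according to the first success `n + j`, which must have `j < r`; bound the preceding
failures by `1` and the success by `(n + j) s`. -/
lemma limRunProb_le_sum (hs : 0 ≤ s) (n r : ℕ) :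
    limRunProb k s n r ≤
      ∑ j ∈ Finset.range r, ((n + j : ℕ) * s) * limRunProb k s (n + j + 1) k := by
  induction r generalizing n with
  | zero => simp [limRunProb]
  | succ r ih =>
    have h : limRunProb k s n (r + 1) ≤ (n * s) * limRunProb k s (n + 1) k +
        limRunProb k s (n + 1) r := by
      refine le_of_tendsto_of_tendsto' ((tendsto_runProb hs n (r + 1)).comp (tendsto_add_atTop_nat 1))
        (((tendsto_runProb hs (n + 1) k).const_mul (n * s)).add (tendsto_runProb hs (n + 1) r))
        fun m => ?_
      simp only [Function.comp_apply]
      rw [runProb_succ_succ]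
      have h1 : 1 - Real.exp (-(n * s)) ≤ n * s := by
        have := Real.add_one_le_exp (-((n : ℝ) * s)); linarith
      have h2 : Real.exp (-(n * s)) ≤ 1 :=
        Real.exp_le_one_iff.2 (neg_nonpos.2 (by positivity))
      have h3 := runProb_nonneg (k := k) hs m (n + 1) k
      have h4 := runProb_nonneg (k := k) hs m (n + 1) r
      nlinarith
    have h2 := ih (n + 1)
    rw [Finset.sum_range_succ']
    have e : ∀ j, n + (j + 1) = n + 1 + j := fun j => by ring
    rw [Finset.sum_congr rfl fun j _ => by rw [e j], add_zero]
    linarith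

/-- The terminal weights tend to `1`, so any `δ < 1` is admissible in `runProb_le` once `m` is
large; then let `δ → 1`. -/
lemma limRunProb_le (hk : 1 ≤ k) (hs : 0 < s) {n : ℕ} (hn : 1 ≤ n) :
    limRunProb k s n k ≤ Real.exp (-gapTail k s (n + (k - 1))) := by
  have hroot : Tendsto (fun z : ℕ => root k (z * s)) atTop (𝓝 0) := by
    have h1 : Tendsto (fun z : ℕ => Real.exp (gapExp k s) * Real.exp (-((z : ℝ) * s))) atTop
        (𝓝 (Real.exp (gapExp k s) * 0)) :=
      (Real.tendsto_exp_neg_atTop_nhds_zero.comp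
        (tendsto_natCast_atTop_atTop.atTop_mul_const hs)).const_mul _
    rw [mul_zero] at h1
    refine tendsto_of_tendsto_of_tendsto_of_le_of_le' tendsto_const_nhds h1 ?_ ?_
    · filter_upwards [eventually_ge_atTop 1] with z hz
      exact (root_pos hk (mul_pos (by exact_mod_cast hz) hs)).le
    · filter_upwards [eventually_ge_atTop 1] with z hz
      have hz' : (1 : ℝ) ≤ z := by exact_mod_cast hz
      have hzs : 0 < (z : ℝ) * s := by positivity
      have h := root_mul_exp_neg_gapExp hk hzs
      rw [Real.exp_neg, ← div_eq_mul_inv, div_eq_iff (Real.exp_pos _).ne'] at h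
      rw [h, mul_comm]
      gcongr
      exact gapExp_antitoneOn hk (Set.mem_Ioi.2 hs) (Set.mem_Ioi.2 hzs) (by nlinarith)
  have hlim : Tendsto (fun z : ℕ => Real.exp (-gapTail k s z) / geom k (root k (z * s))) atTop
      (𝓝 1) := by
    have h1 := (Real.continuous_exp.tendsto _).comp (tendsto_gapTail k s).neg
    have h2 := ((continuous_geom k).tendsto _).comp hroot
    have h0 : geom k 0 = 1 := by
      obtain ⟨l, rfl⟩ : ∃ l, k = l + 1 := ⟨k - 1, by omega⟩
      rw [geom_succ']; simp
    rw [h0] at h2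
    have h3 := h1.div h2 one_ne_zero
    rw [neg_zero, Real.exp_zero, div_one] at h3
    exact h3
  have key : ∀ δ : ℝ, 0 ≤ δ → δ < 1 →
      δ * limRunProb k s n k ≤ Real.exp (-gapTail k s (n + (k - 1))) := by
    intro δ h0 h1
    obtain ⟨m, hm⟩ := eventually_atTop.1 (hlim.eventually_const_le h1)
    obtain ⟨l, hl⟩ : ∃ l, k = l + 1 := ⟨k - 1, by omega⟩
    have h := runProb_le hk hs m hn (r := l) hl.ge (fun z hz => hm z (by omega))
    rw [← hl, sub_self, zero_mul, Real.exp_zero, one_mul, div_self, one_mul] at h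
    · rw [show k - 1 = l by omega]
      exact (mul_le_mul_of_nonneg_left (ciInf_le (bddBelow_runProb hs.le n k) m) h0).trans h
    · exact (geom_pos hk (root_pos hk (mul_pos (by norm_cast; omega) hs)).le).ne'
  have hc : Tendsto (fun δ : ℝ => δ * limRunProb k s n k) (𝓝[<] 1)
      (𝓝 (1 * limRunProb k s n k)) :=
    (tendsto_id.mul_const _).mono_left nhdsWithin_le_nhds
  rw [one_mul] at hc
  refine le_of_tendsto hc ?_
  filter_upwards [Ioo_mem_nhdsLT (zero_lt_one (α := ℝ))] with δ hδ using key δ hδ.1.le hδ.2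

end bounds

/-! ### Scaling in `s` and the constants. -/

/-- The probability `limRunProb k s n k`, multiplied by
`s ^ ((2 k - 1) / (2 k) + (n - 1) / k) * exp (gapConst k / s)`. -/
noncomputable def scaledProb (k n : ℕ) (s : ℝ) : ℝ :=
  limRunProb k s n k * Real.exp (gapConst k / s + (2 * k - 1) / (2 * k) * Real.log s +
    (n - 1) / k * Real.log s)

/-- The constants that bound `scaledProb k n` near `0` after unfolding its recursion. -/
noncomputable def scaledConst (k : ℕ) (c : ℝ) : ℕ → ℕ → ℝ
  | 0, n => Real.exp ((c - Real.log (n - 1 + (k - 1)).factorial) / k)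
  | M + 1, n => (n + (k - 1) : ℕ) * scaledConst k c M (n + k)

lemma tendsto_const_mul_nhdsGT_zero (a : ℝ) :
    Tendsto (fun s : ℝ => a * s) (𝓝[>] 0) (𝓝 0) := by
  have : Tendsto (fun s : ℝ => a * s) (𝓝 0) (𝓝 (a * 0)) := tendsto_id.const_mul _
  rw [mul_zero] at this
  exact this.mono_left nhdsWithin_le_nhds

lemma scaledProb_le_of_gapTail {k : ℕ} (hk : 1 ≤ k) {N : ℕ} (hN : 1 ≤ N) {n : ℕ} (hn : 1 ≤ n) :
    ∃ β : ℝ → ℝ, Tendsto β (𝓝[>] 0) (𝓝 (scaledConst k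
      (Real.log N.factorial + N - (N + 1 / 2) * Real.log N) 0 n)) ∧
      ∀ s : ℝ, 0 < s → scaledProb k n s ≤ β s := by
  obtain ⟨n, rfl⟩ : ∃ l, n = l + 1 := ⟨n - 1, by omega⟩
  have hk' : (0 : ℝ) < k := by exact_mod_cast hk
  obtain ⟨η, hη, hle⟩ := neg_gapTail_one_le hk hN
  set c := Real.log N.factorial + N - (N + 1 / 2) * Real.log N
  rw [scaledConst, Nat.add_sub_cancel]
  set L := n + (k - 1) with hL
  set S : ℝ := ∑ j ∈ Finset.range L, ((1 + j : ℕ) : ℝ)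
  refine ⟨fun s => Real.exp ((c - Real.log L.factorial + η s + (k + 1) * S * s) / k), ?_, ?_⟩
  · have h := ((hη.const_add (c - Real.log L.factorial)).add
      (tendsto_const_mul_nhdsGT_zero ((k + 1) * S))).div_const (k : ℝ)
    simp only [add_zero] at h
    exact (Real.continuous_exp.tendsto _).comp h
  · intro s hs
    rw [scaledProb]
    refine (mul_le_mul_of_nonneg_right (limRunProb_le hk hs (by omega))
      (Real.exp_pos _).le).trans ?_
    rw [← Real.exp_add, Real.exp_le_exp]
    have h1 := hle s hs
    have h2 := gapTail_eq_sum_add hk hs 1 L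
    rw [show 1 + L = n + 1 + (k - 1) by omega] at h2
    have h3 : k * ∑ j ∈ Finset.range L, gapExp k (((1 + j : ℕ) : ℝ) * s) ≤
        (k + 1) * S * s - Real.log L.factorial - L * Real.log s := by
      have hlog : ∑ j ∈ Finset.range L, Real.log (((1 + j : ℕ) : ℝ) * s) =
          Real.log L.factorial + L * Real.log s := by
        rw [← Finset.prod_range_add_one_eq_factorial, Nat.cast_prod, Real.log_prod
          (fun j _ => by positivity), Finset.sum_congr rfl fun j _ => Real.log_mul (by positivity)
          hs.ne', Finset.sum_add_distrib, Finset.sum_const, Finset.card_range, nsmul_eq_mul]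
        simp only [add_comm 1]
      have h := Finset.sum_le_sum fun j (_ : j ∈ Finset.range L) =>
        mul_gapExp_add_log_le hk (t := ((1 + j : ℕ) : ℝ) * s) (by positivity)
      rw [Finset.sum_add_distrib, hlog, ← Finset.mul_sum, ← Finset.mul_sum, ← Finset.sum_mul] at h
      linarith
    have hLr : (L : ℝ) = n + k - 1 := by
      rw [hL]; push_cast [Nat.cast_sub hk]; ring
    rw [hLr] at h3
    rw [mul_comm, ← le_div_iff₀ hk'] at h3
    have h4 : -gapTail k s (n + 1 + (k - 1)) ≤ -(gapConst k / s) - Real.log s / (2 * k) +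
        (c + η s) / k + ((k + 1) * S * s - Real.log L.factorial - (n + k - 1) * Real.log s) / k := by
      linarith
    have h5 := sub_nonneg.2 h4
    rw [← sub_nonneg]
    refine h5.trans_eq ?_
    push_cast
    field_simp
    ring

/-- The powers of `s` balance exactly for `j = k - 1`; all other terms keep a positive power and
vanish in the limit, which explains the recursion of `scaledConst`. -/
lemma scaledProb_le_sum {k : ℕ} (hk : 1 ≤ k) (n : ℕ) {s : ℝ} (hs : 0 < s) :
    scaledProb k n s ≤ ∑ j ∈ Finset.range k,
      (n + j : ℕ) * Real.exp ((1 - (j + 1) / k) * Real.log s) * scaledProb k (n + j + 1) s := by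
  have hk' : (0 : ℝ) < k := by exact_mod_cast hk
  rw [scaledProb]
  refine (mul_le_mul_of_nonneg_right (limRunProb_le_sum hs.le n k) (Real.exp_pos _).le).trans_eq ?_
  rw [Finset.sum_mul]
  refine Finset.sum_congr rfl fun j _ => ?_
  have e : gapConst k / s + (2 * k - 1) / (2 * k) * Real.log s + (n - 1) / k * Real.log s +
      Real.log s = (1 - (j + 1) / k) * Real.log s + (gapConst k / s +
        (2 * k - 1) / (2 * k) * Real.log s + ((n + j + 1 : ℕ) - 1) / k * Real.log s) := by
    push_cast
    field_simp
    ring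
  have e2 := congrArg Real.exp e
  rw [Real.exp_add, Real.exp_add ((1 - (j + 1) / k) * Real.log s), Real.exp_log hs] at e2
  rw [scaledProb]
  linear_combination ((n + j : ℕ) : ℝ) * limRunProb k s (n + j + 1) k * e2

lemma exists_scaledProb_le {k : ℕ} (hk : 1 ≤ k) {N : ℕ} (hN : 1 ≤ N) (M : ℕ) {n : ℕ}
    (hn : 1 ≤ n) :
    ∃ β : ℝ → ℝ, Tendsto β (𝓝[>] 0) (𝓝 (scaledConst k
      (Real.log N.factorial + N - (N + 1 / 2) * Real.log N) M n)) ∧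
      ∀ s : ℝ, 0 < s → scaledProb k n s ≤ β s := by
  induction M generalizing n with
  | zero => exact scaledProb_le_of_gapTail hk hN hn
  | succ M ih =>
    have hk' : (0 : ℝ) < k := by exact_mod_cast hk
    set c := Real.log N.factorial + N - (N + 1 / 2) * Real.log N
    choose! β hβ hle using fun n (hn : 1 ≤ n) => ih (n := n) hn
    refine ⟨fun s => ∑ j ∈ Finset.range k,
      (n + j : ℕ) * Real.exp ((1 - (j + 1) / k) * Real.log s) * β (n + j + 1) s, ?_, ?_⟩
    · obtain ⟨l, hl⟩ : ∃ l, k = l + 1 := ⟨k - 1, by omega⟩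
      have hlast : Tendsto (fun s => ((n + l : ℕ) : ℝ) *
          Real.exp ((1 - ((l : ℝ) + 1) / k) * Real.log s) * β (n + l + 1) s) (𝓝[>] 0)
          (𝓝 (scaledConst k c (M + 1) n)) := by
        have h0 : 1 - ((l : ℝ) + 1) / k = 0 := by rw [hl]; push_cast; field_simp; ring
        simp only [h0, zero_mul, Real.exp_zero, mul_one]
        rw [scaledConst, show k - 1 = l by omega, show n + k = n + l + 1 by omega]
        exact (hβ _ (by omega)).const_mul _
      have hsmall : ∀ j ∈ Finset.range l, Tendsto (fun s => ((n + j : ℕ) : ℝ) *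
          Real.exp ((1 - ((j : ℝ) + 1) / k) * Real.log s) * β (n + j + 1) s) (𝓝[>] 0)
          (𝓝 0) := by
        intro j hj
        have hj' : (j : ℝ) + 1 < k := by
          have := Finset.mem_range.1 hj
          exact_mod_cast (show j + 1 < k by omega)
        have h0 : 0 < 1 - ((j : ℝ) + 1) / k := by
          rw [sub_pos, div_lt_one hk']; exact hj'
        have h1 := Real.tendsto_exp_atBot.comp (Real.tendsto_log_nhdsGT_zero.const_mul_atBot h0)
        have h2 := (h1.const_mul ((n + j : ℕ) : ℝ)).mul (hβ (n + j + 1) (by omega))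
        simpa using h2
      have h := (tendsto_finsetSum (Finset.range l) hsmall).add hlast
      rw [Finset.sum_const_zero, zero_add] at h
      refine h.congr fun s => ?_
      have := Finset.sum_range_succ (fun j : ℕ => ((n + j : ℕ) : ℝ) *
        Real.exp ((1 - ((j : ℝ) + 1) / k) * Real.log s) * β (n + j + 1) s) l
      rw [← this, hl]
    · intro s hs
      refine (scaledProb_le_sum hk n hs).trans (Finset.sum_le_sum fun j _ => ?_)
      gcongr
      exact hle _ (by omega) s hs

lemma scaledConst_one_eq (N : ℕ) (hN : 1 ≤ N) :
    scaledConst 1 (Real.log N.factorial + N - (N + 1 / 2) * Real.log N) 0 1 =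
      Real.sqrt 2 * Stirling.stirlingSeq N := by
  have hN' : (0 : ℝ) < N := by exact_mod_cast hN
  simp only [scaledConst, Nat.sub_self, add_zero, Nat.factorial_zero, Nat.cast_one, Real.log_one,
    sub_zero, div_one]
  have h : (N + 1 / 2) * Real.log N = Real.log (Real.sqrt N) + N * Real.log N := by
    rw [Real.log_sqrt hN'.le]; ring
  rw [Stirling.stirlingSeq, h, Real.exp_sub, Real.exp_add, Real.exp_add, Real.exp_log
    (by positivity), Real.exp_log (by positivity), Real.exp_nat_mul, Real.exp_log hN',
    Real.sqrt_mul (by norm_num), div_pow, ← Real.exp_nat_mul, mul_one]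
  field_simp

lemma mul_exp_le_one {k : ℕ} (hk : k ≠ 0) {a b : ℝ} (ha : 0 ≤ a) (hb : 0 < b)
    (h : a ^ k * Real.exp 1 ≤ b) : a * Real.exp ((1 - Real.log b) / k) ≤ 1 := by
  rw [← pow_le_one_iff_of_nonneg (by positivity) hk, mul_pow, ← Real.exp_nat_mul,
    mul_div_cancel₀ _ (by exact_mod_cast hk), Real.exp_sub, Real.exp_log hb, ← mul_div_assoc,
    div_le_one hb]
  exact h

lemma exists_scaledConst_le_one {k : ℕ} (hk : 2 ≤ k) : ∃ M, scaledConst k 1 M 1 ≤ 1 := by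
  have he := Real.exp_one_lt_d9
  rcases (by omega : k = 2 ∨ k = 3 ∨ 4 ≤ k) with rfl | rfl | hk
  -- Six unfoldings lead from `n = 1` to `n = 13` with factor `2 · 4 ⋯ 12 = 46080`, and `46080 ^ 2 *
  -- e ≤ 13!`.
  · refine ⟨6, ?_⟩
    have := mul_exp_le_one (k := 2) (a := 46080) (b := (13).factorial) (by norm_num) (by norm_num)
      (by positivity) (by norm_num [Nat.factorial]; linarith)
    simp only [scaledConst]
    norm_num at this ⊢
    linarith
  -- One unfolding suffices: `3 ^ 3 * e ≤ 5!`.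
  · refine ⟨1, ?_⟩
    have := mul_exp_le_one (k := 3) (a := 3) (b := (5).factorial) (by norm_num) (by norm_num)
      (by positivity) (by norm_num [Nat.factorial]; linarith)
    simp only [scaledConst]
    norm_num at this ⊢
    linarith
  · refine ⟨0, ?_⟩
    have h6 : (6 : ℝ) ≤ (k - 1).factorial := by
      exact_mod_cast Nat.factorial_le (show 3 ≤ k - 1 by omega)
    have := mul_exp_le_one (k := k) (a := 1) (b := (k - 1).factorial) (by omega) (by norm_num)
      (by positivity) (by rw [one_pow]; linarith)
    simpa [scaledConst] using this

lemma eventually_scaledProb_le {k : ℕ} (hk : 1 ≤ k) {κ : ℝ}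
    (hκ : (if k = 1 then Real.sqrt (2 * Real.pi) else 1) < κ) :
    ∀ᶠ s in 𝓝[>] (0 : ℝ), scaledProb k 1 s ≤ κ := by
  obtain ⟨N, M, hN, hlt⟩ : ∃ N M : ℕ, 1 ≤ N ∧
      scaledConst k (Real.log N.factorial + N - (N + 1 / 2) * Real.log N) M 1 < κ := by
    split_ifs at hκ with h
    · subst h
      have h := Stirling.tendsto_stirlingSeq_sqrt_pi.const_mul (Real.sqrt 2)
      rw [← Real.sqrt_mul (by norm_num)] at h
      obtain ⟨N, h1, h2⟩ := ((h.eventually_lt_const hκ).and (eventually_ge_atTop 1)).exists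
      exact ⟨N, 0, h2, by rw [scaledConst_one_eq N h2]; exact h1⟩
    · obtain ⟨M, hM⟩ := exists_scaledConst_le_one (k := k) (by omega)
      -- At `N = 1` the Stirling expression equals `1`.
      exact ⟨1, M, le_rfl, lt_of_le_of_lt (by simpa using hM) hκ⟩
  obtain ⟨β, hβ, hle⟩ := exists_scaledProb_le hk hN M le_rfl
  filter_upwards [hβ.eventually_le_const hlt, self_mem_nhdsWithin] with s h1 h2
  exact (hle s h2).trans h1

/-! ### From events to the recursion. -/

section events

variable {Ω : Type*}

/-- The event that, among the trials `n, n + 1, …, n + m - 1`, trial `l` succeeding on `C l`, there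
are neither `r` failures at the start nor `k` consecutive failures elsewhere. -/
def runEvent (C : ℕ → Set Ω) (k : ℕ) : ℕ → ℕ → ℕ → Set Ω
  | _, _, 0 => ∅
  | 0, _, _ + 1 => Set.univ
  | m + 1, n, r + 1 => C n ∩ runEvent C k m (n + 1) k ∪ (C n)ᶜ ∩ runEvent C k m (n + 1) r

variable (C : ℕ → Set Ω) (k : ℕ)

@[simp] lemma runEvent_right_zero (m n : ℕ) : runEvent C k m n 0 = ∅ := by
  cases m <;> simp [runEvent]

lemma runEvent_succ_succ (m n r : ℕ) : runEvent C k (m + 1) n (r + 1) =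
    C n ∩ runEvent C k m (n + 1) k ∪ (C n)ᶜ ∩ runEvent C k m (n + 1) r := by
  rw [runEvent]

lemma runEvent_antitone (n r : ℕ) : Antitone fun m => runEvent C k m n r := by
  refine antitone_nat_of_succ_le fun m => ?_
  induction m generalizing n r with
  | zero => cases r <;> simp [runEvent]
  | succ m ih =>
    cases r with
    | zero => simp
    | succ r =>
      rw [runEvent_succ_succ, runEvent_succ_succ]
      exact Set.union_subset_union (Set.inter_subset_inter_right _ (ih _ _))
        (Set.inter_subset_inter_right _ (ih _ _))

variable {C k}

lemma mem_runEvent {ω : Ω} (m : ℕ) {n r : ℕ} (h0 : ∃ j < r, ω ∈ C (n + j))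
    (h : ∀ i, n ≤ i → ∃ j < k, ω ∈ C (i + j)) : ω ∈ runEvent C k m n r := by
  induction m generalizing n r with
  | zero =>
    obtain ⟨j, hj, -⟩ := h0
    obtain ⟨r, rfl⟩ : ∃ l, r = l + 1 := ⟨r - 1, by omega⟩
    simp [runEvent]
  | succ m ih =>
    obtain ⟨j, hj, hω⟩ := h0
    obtain ⟨r, rfl⟩ : ∃ l, r = l + 1 := ⟨r - 1, by omega⟩
    rw [runEvent_succ_succ]
    by_cases hn : ω ∈ C n
    · exact Or.inl ⟨hn, ih (h (n + 1) (by omega)) fun i hi => h i (by omega)⟩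
    · refine Or.inr ⟨hn, ih ?_ fun i hi => h i (by omega)⟩
      rcases j with _ | j
      · exact absurd hω hn
      · exact ⟨j, by omega, by rwa [show n + 1 + j = n + (j + 1) by omega]⟩

lemma notMem_runEvent_of_start {ω : Ω} {m n r : ℕ} (hm : r ≤ m) (h : ∀ j < r, ω ∉ C (n + j)) :
    ω ∉ runEvent C k m n r := by
  induction r generalizing m n with
  | zero => simp
  | succ r ih =>
    obtain ⟨m, rfl⟩ : ∃ l, m = l + 1 := ⟨m - 1, by omega⟩
    rw [runEvent_succ_succ]
    rintro (h1 | h1)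
    · exact h 0 (by omega) h1.1
    · exact ih (by omega) (fun j hj => by
        rw [show n + 1 + j = n + (j + 1) by omega]; exact h (j + 1) (by omega)) h1.2

/-- From `n`, exactly `d + k` trials reach the end of the window of failures that starts at `n + d`;
since `r ≤ k`, no allowance survives it. -/
lemma notMem_runEvent {ω : Ω} (d : ℕ) {n r : ℕ} (hr : r ≤ k) (h : ∀ j < k, ω ∉ C (n + d + j)) :
    ω ∉ runEvent C k (d + k) n r := by
  induction d generalizing n r with
  | zero => exact notMem_runEvent_of_start (by omega) fun j hj => h j (by omega)
  | succ d ih =>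
    have h' : ∀ j < k, ω ∉ C (n + 1 + d + j) := by
      intro j hj; rw [show n + 1 + d + j = n + (d + 1) + j by omega]; exact h j hj
    cases r with
    | zero => simp
    | succ r =>
      rw [show d + 1 + k = (d + k) + 1 by omega, runEvent_succ_succ]
      rintro (h1 | h1)
      · exact ih le_rfl h' h1.2
      · exact ih (by omega) h' h1.2

lemma noGap_eq_iInter_runEvent : noGap C k = ⋂ m, runEvent C k m 1 k := by
  ext ω
  simp only [noGap, Set.mem_iInter, Set.mem_iUnion, Set.mem_Ici, Set.mem_Iio, exists_prop]
  constructor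
  · intro h m
    exact mem_runEvent m (h 1 le_rfl) h
  · intro h i hi
    by_contra! hc
    refine notMem_runEvent (n := 1) (i - 1) le_rfl ?_ (h (i - 1 + k))
    intro j hj
    rw [show 1 + (i - 1) + j = i + j by omega]
    exact hc j hj

/-- Only the events `C l` with `l ≥ n` enter, so at `n + 1` the event is independent of `C n`. The
generators are indexed by `C (l + 1)` to match the independence hypothesis. -/
lemma measurableSet_runEvent (m n r : ℕ) (hn : 1 ≤ n) :
    MeasurableSet[MeasurableSpace.generateFrom {t | ∃ l ∈ {l : ℕ | n ≤ l + 1}, C (l + 1) = t}]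
      (runEvent C k m n r) := by
  induction m generalizing n r with
  | zero =>
    cases r with
    | zero => rw [runEvent_right_zero]; exact @MeasurableSet.empty Ω (MeasurableSpace.generateFrom _)
    | succ r => rw [runEvent]; exact @MeasurableSet.univ Ω (MeasurableSpace.generateFrom _)
  | succ m ih =>
    cases r with
    | zero => rw [runEvent_right_zero]; exact @MeasurableSet.empty Ω (MeasurableSpace.generateFrom _)
    | succ r =>
      rw [runEvent_succ_succ]
      have hle : MeasurableSpace.generateFrom {t | ∃ l ∈ {l : ℕ | n + 1 ≤ l + 1}, C (l + 1) = t} ≤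
          MeasurableSpace.generateFrom {t | ∃ l ∈ {l : ℕ | n ≤ l + 1}, C (l + 1) = t} := by
        refine MeasurableSpace.generateFrom_mono ?_
        rintro t ⟨l, hl, rfl⟩
        exact ⟨l, (Nat.le_succ n).trans hl, rfl⟩
      have hC : MeasurableSet[MeasurableSpace.generateFrom
          {t | ∃ l ∈ {l : ℕ | n ≤ l + 1}, C (l + 1) = t}] (C n) := by
        refine MeasurableSpace.measurableSet_generateFrom ⟨n - 1, ?_, ?_⟩
        · show n ≤ n - 1 + 1
          omega
        · rw [show n - 1 + 1 = n by omega]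
      exact (hC.inter (hle _ (ih (n + 1) k (by omega)))).union
        (hC.compl.inter (hle _ (ih (n + 1) r (by omega))))

variable [MeasurableSpace Ω] {P : Measure Ω} {s : ℝ}

lemma IsExpEvents.generateFrom_le (h : IsExpEvents P s C) (S : Set ℕ) :
    MeasurableSpace.generateFrom {t | ∃ l ∈ S, C (l + 1) = t} ≤ ‹MeasurableSpace Ω› := by
  refine MeasurableSpace.generateFrom_le ?_
  rintro t ⟨l, -, rfl⟩
  exact h.measurableSet (l + 1) (by omega)

variable [IsProbabilityMeasure P]

lemma IsExpEvents.real_runEvent (h : IsExpEvents P s C) (m n r : ℕ) (hn : 1 ≤ n) :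
    P.real (runEvent C k m n r) = runProb k s m n r := by
  induction m generalizing n r with
  | zero => cases r <;> simp [runEvent, runProb]
  | succ m ih =>
    cases r with
    | zero => simp
    | succ r =>
      have hind := iIndepSet.indep_generateFrom_of_disjoint
        (fun l => h.measurableSet (l + 1) (by omega)) h.indep {n - 1} {l : ℕ | n + 1 ≤ l + 1}
        (by
          rw [Set.disjoint_singleton_left]
          show ¬ n + 1 ≤ n - 1 + 1
          omega)
      have hCn : MeasurableSet (C n) := h.measurableSet n hn
      have hC : MeasurableSet[MeasurableSpace.generateFrom
          {t | ∃ l ∈ ({n - 1} : Set ℕ), C (l + 1) = t}] (C n) :=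
        MeasurableSpace.measurableSet_generateFrom
          ⟨n - 1, rfl, by rw [show n - 1 + 1 = n by omega]⟩
      have hR : ∀ r, MeasurableSet[MeasurableSpace.generateFrom
          {t | ∃ l ∈ {l : ℕ | n + 1 ≤ l + 1}, C (l + 1) = t}] (runEvent C k m (n + 1) r) :=
        fun r => measurableSet_runEvent m (n + 1) r (by omega)
      have hR' := fun r => h.generateFrom_le _ _ (hR r)
      have e1 := (Indep_iff _ _ _).1 hind _ _ hC (hR k)
      have e2 := (Indep_iff _ _ _).1 hind _ _ hC.compl (hR r)
      have hpr := h.prob n hn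
      have hprc : P.real (C n)ᶜ = Real.exp (-(n * s)) := by
        rw [probReal_compl_eq_one_sub hCn, hpr]; ring
      rw [runEvent_succ_succ, measureReal_union
        (Set.disjoint_left.2 fun ω h1 h2 => h2.1 h1.1) (hCn.compl.inter (hR' r)),
        runProb_succ_succ, ← ih (n + 1) k (by omega), ← ih (n + 1) r (by omega), ← hpr, ← hprc]
      simp only [Measure.real, e1, e2, ENNReal.toReal_mul]

lemma IsExpEvents.real_noGap (h : IsExpEvents P s C) (hs : 0 ≤ s) :
    P.real (noGap C k) = limRunProb k s 1 k := by
  have hlim := tendsto_measure_iInter_atTop (μ := P) (s := fun m => runEvent C k m 1 k)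
    (fun m => (h.generateFrom_le _ _ (measurableSet_runEvent m 1 k le_rfl)).nullMeasurableSet)
    (runEvent_antitone C k 1 k) ⟨0, measure_ne_top _ _⟩
  rw [← noGap_eq_iInter_runEvent] at hlim
  have h2 := (ENNReal.tendsto_toReal (measure_ne_top P (noGap C k))).comp hlim
  refine tendsto_nhds_unique (h2.congr fun m => ?_) (tendsto_runProb hs 1 k)
  exact h.real_runEvent m 1 k le_rfl

end events

/-! ### The two inequalities. -/

lemma exp_neg_gapConst_div_le_limRunProb {k : ℕ} (hk : 1 ≤ k) {s : ℝ} (hs : 0 < s) :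
    Real.exp (-(gapConst k / s)) ≤ limRunProb k s 1 k := by
  refine le_ciInf fun m => le_trans ?_ (le_runProb hk hs m le_rfl le_rfl)
  rw [div_self (geom_pos hk (root_pos hk (by simpa using hs)).le).ne', mul_one,
    Real.exp_le_exp, neg_le_neg_iff]
  exact gapTail_one_le hk hs

theorem theorem1p2 (k : ℕ) (hk : 1 ≤ k) :
    ∃ ε : ℝ → ℝ, Tendsto ε (𝓝[>] 0) (𝓝 0) ∧
      ∀ (s : ℝ), 0 < s → s < 1 →
      ∀ (Ω : Type*) [MeasurableSpace Ω] (P : Measure Ω) [IsProbabilityMeasure P]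
        (C : ℕ → Set Ω), IsExpEvents P s C →
        Real.exp (-(gapConst k / s)) ≤ P.real (noGap C k) ∧
        P.real (noGap C k) ≤
          (if k = 1 then Real.sqrt (2 * Real.pi) else 1) *
            s ^ (-((2 * (k : ℝ) - 1) / (2 * (k : ℝ)))) *
            Real.exp (-(gapConst k / s)) * (1 + ε s) := by
  set κ : ℝ := if k = 1 then Real.sqrt (2 * Real.pi) else 1 with hκ
  have hκ0 : 0 < κ := by
    rw [hκ]
    split_ifs <;> positivity
  -- The relative excess over `κ`, cut off at `0`: the upper bound then holds for every `s`, and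
  -- only an asymptotic upper bound on `scaledProb` is needed for the limit.
  refine ⟨fun s => max 0 (scaledProb k 1 s / κ - 1), ?_, ?_⟩
  · refine tendsto_order.2 ⟨fun a ha => Eventually.of_forall fun s => ha.trans_le (le_max_left _ _),
      fun a ha => ?_⟩
    have hlt : κ < κ * (1 + a / 2) := by nlinarith
    filter_upwards [eventually_scaledProb_le hk hlt] with s hs
    refine max_lt ha ?_
    have : scaledProb k 1 s / κ ≤ 1 + a / 2 := by rwa [div_le_iff₀' hκ0]
    linarith
  · intro s hs _ Ω _ P _ C h
    rw [h.real_noGap hs.le]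
    refine ⟨exp_neg_gapConst_div_le_limRunProb hk hs, ?_⟩
    have h1 : scaledProb k 1 s ≤ κ * (1 + max 0 (scaledProb k 1 s / κ - 1)) := by
      rw [← div_le_iff₀' hκ0]
      linarith [le_max_right 0 (scaledProb k 1 s / κ - 1)]
    have h2 : limRunProb k s 1 k = scaledProb k 1 s *
        (s ^ (-((2 * (k : ℝ) - 1) / (2 * (k : ℝ)))) * Real.exp (-(gapConst k / s))) := by
      rw [scaledProb, Real.rpow_def_of_pos hs, ← Real.exp_add, mul_assoc, ← Real.exp_add]
      simp only [Nat.cast_one, sub_self, zero_div, zero_mul, add_zero]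
      rw [show gapConst k / s + (2 * k - 1) / (2 * k) * Real.log s +
        (Real.log s * -((2 * k - 1) / (2 * k)) + -(gapConst k / s)) = 0 by ring, Real.exp_zero,
        mul_one]
    rw [h2]
    have := mul_le_mul_of_nonneg_right h1
      (mul_pos (Real.rpow_pos_of_pos hs (-((2 * (k : ℝ) - 1) / (2 * (k : ℝ)))))
        (Real.exp_pos (-(gapConst k / s)))).le
    refine this.trans_eq ?_
    ring
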